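/- Let $(\Omega,\mathcal A,\mathbb P)$ be a probability space, let $\mathbb S^2$ be the unit sphere in $\mathbb R^3$ with geodesic distance $d(x,y)=\arccos\langle x,y\rangle$ and surface measure $\sigma$, and let $(Y_{\ell m})_{\ell\ge 0,\,-\ell\le m\le\ell}$ be the standard complex orthonormal spherical harmonics. Let $T:\Omega\times\mathbb S^2\to\mathbb R$ be an isotropic Gaussian random field, i.e. $T$ is jointly measurable, all vectors $(T(x_1),\dots,T(x_k))$ are (possibly degenerate) multivariate Gaussian, and for all rotations $g\in SO(3)$ and all $x,y\in\mathbb S^2$ one has $\mathbb E(T(x)^2)<\infty$, $\mathbb E(T(x))=\mathbb E(T(gx))$ and $\mathbb E(T(x)T(y))=\mathbb E(T(gx)T(gy))$. Let $(A_\ell)_{\ell\ge0}$ be its angular power spectrum: with $a_{\ell m}=\int_{\mathbb S^2}T(y)\overline{Y_{\ell m}(y)}\,d\sigma(y)$, it is the sequence of nonnegative reals determined by $\mathbb E(a_{\ell m}\overline{a_{\ell' m'}})=A_\ell\,\delta_{\ell\ell'}\delta_{mm'}$ for $\ell,\ell'\ge1$ and $\mathbb E(a_{00}\overline{a_{\ell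 m}})=(A_0+(\mathbb E a_{00})^2)\,\delta_{0\ell}\delta_{0m}$. Suppose that $\sum_{\ell=0}^\infty A_\ell\,\ell^{1+\beta}<\infty$ for some $\beta\in(0,2]$. Then there is a random field $\tilde T$ on $\mathbb S^2$ with $\mathbb P(\tilde T(x)=T(x))=1$ for every $x\in\mathbb S^2$ such that every path $x\mapsto\tilde T(\omega,x)$ is continuous and, for every $\gamma\in(0,\beta/2)$, Hölder continuous on $\mathbb S^2$ with exponent $\gamma$: for every $\omega\in\Omega$ and $\gamma\in(0,\beta/2)$ there is $C<\infty$ with $|\tilde T(\omega,x)-\tilde T(\omega,y)|\le C\,d(x,y)^\gamma$ for all $x,y\in\mathbb S^2$. -/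

import Mathlib

open MeasureTheory ProbabilityTheory
open scoped ComplexConjugate

noncomputable section

namespace SphereField

/-- Euclidean space `ℝ³`. -/
abbrev E3 : Type := EuclideanSpace ℝ (Fin 3)

/-- The unit sphere `S²` in `ℝ³`, with its Borel `σ`-algebra. -/
abbrev S2 : Type := Metric.sphere (0 : E3) 1

/-- The geodesic distance `d(x, y) = arccos ⟨x, y⟩` on the unit sphere. -/
def geodesicDist (x y : S2) : ℝ := Real.arccos (inner ℝ (x : E3) (y : E3))

/-- The Lebesgue (surface) measure on the unit sphere, of total mass `4π`. -/
def surfaceMeasure : Measure S2 := (volume : Measure E3).toSphere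

/-- The image of a point of the sphere under a linear isometry of `ℝ³`. -/
def rotate (g : E3 ≃ₗᵢ[ℝ] E3) (x : S2) : S2 :=
  ⟨g (x : E3), by simp [mem_sphere_iff_norm]⟩

/-- The rotations of `ℝ³`, i.e. the elements of `SO(3)`: linear isometries of determinant `1`. -/
def IsRotation (g : E3 ≃ₗᵢ[ℝ] E3) : Prop :=
  LinearMap.det (g.toLinearEquiv : E3 →ₗ[ℝ] E3) = 1

/-! ### Random fields -/

section Fields

variable {Ω : Type*} [MeasurableSpace Ω]

/-- A real-valued random field on `S²`: a jointly measurable map `Ω × S² → ℝ`. -/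
def IsRandomField (T : Ω → S2 → ℝ) : Prop :=
  Measurable (fun p : Ω × S2 => T p.1 p.2)

/-- `n`-weak isotropy: finite absolute `n`-th moments, and rotation invariance of all joint
moments of orders `1, …, n`. -/
structure IsWeaklyIsotropic (n : ℕ) (P : Measure Ω) (T : Ω → S2 → ℝ) : Prop where
  integrable : ∀ x : S2, Integrable (fun ω => |T ω x| ^ n) P
  moments : ∀ k : ℕ, 1 ≤ k → k ≤ n → ∀ (x : Fin k → S2) (g : E3 ≃ₗᵢ[ℝ] E3), IsRotation g →
    ∫ ω, ∏ i, T ω (x i) ∂P = ∫ ω, ∏ i, T ω (rotate g (x i)) ∂P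

/-- An isotropic Gaussian random field on `S²`: a `2`-weakly isotropic random field all of whose
finite-dimensional distributions are (possibly degenerate) Gaussian. -/
structure IsIsotropicGRF (P : Measure Ω) (T : Ω → S2 → ℝ) : Prop where
  isRandomField : IsRandomField T
  isGaussian : IsGaussianProcess (fun (x : S2) (ω : Ω) => T ω x) P
  isIsotropic : IsWeaklyIsotropic 2 P T

/-- `T'` is a modification of `T`: for every `x`, almost surely `T'(x) = T(x)`. -/
def IsModificationOf (P : Measure Ω) (T' T : Ω → S2 → ℝ) : Prop :=
  ∀ x : S2, ∀ᵐ ω ∂P, T' ω x = T ω x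

end Fields

/-- Hölder continuity with exponent `γ` on the sphere with its geodesic distance. -/
def IsHolder (γ : ℝ) (f : S2 → ℝ) : Prop :=
  ∃ C : ℝ, ∀ x y : S2, |f x - f y| ≤ C * geodesicDist x y ^ γ

/-! ### Spherical harmonics -/

/-- The Legendre polynomial `P_ℓ`, by Rodrigues' formula. -/
def legendre (l : ℕ) : Polynomial ℝ :=
  Polynomial.C ((2 : ℝ)⁻¹ ^ l * ((l.factorial : ℝ))⁻¹) *
    Polynomial.derivative^[l] ((Polynomial.X ^ 2 - 1) ^ l)

/-- The associated Legendre function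
`P_{ℓm}(μ) = (-1)^m (1 - μ²)^{m/2} (d/dμ)^m P_ℓ(μ)` for `μ ∈ [-1, 1]`. -/
def assocLegendre (l m : ℕ) (μ : ℝ) : ℝ :=
  (-1) ^ m * Real.sqrt (1 - μ ^ 2) ^ m * (Polynomial.derivative^[m] (legendre l)).eval μ

/-- The longitude of `y = (sin ϑ cos φ, sin ϑ sin φ, cos ϑ)`, as an angle modulo `2π` with
representative in `(-π, π]` (and `0` at the two poles). -/
def longitude (y : S2) : ℝ :=
  Complex.arg (((y : E3) 0 : ℂ) + ((y : E3) 1 : ℂ) * Complex.I)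

/-- The spherical harmonic `Y_{ℓm}` for `0 ≤ m ≤ ℓ`,
`√((2ℓ+1)/(4π) · (ℓ-m)!/(ℓ+m)!) P_{ℓm}(cos ϑ) e^{imφ}`, where `cos ϑ` is the third Cartesian
coordinate of the point. -/
def sphericalHarmonicNonneg (l m : ℕ) (y : S2) : ℂ :=
  (Real.sqrt ((2 * l + 1) / (4 * Real.pi) * (((l - m).factorial : ℝ) / ((l + m).factorial : ℝ))) *
    assocLegendre l m ((y : E3) 2) : ℝ) *
    Complex.exp (Complex.I * (m : ℂ) * (longitude y : ℂ))

/-- The spherical harmonic `Y_{ℓm}` for `-ℓ ≤ m ≤ ℓ`, with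
`Y_{ℓm} = (-1)^m conj Y_{ℓ,-m}` for `m < 0`. -/
def sphericalHarmonic (l : ℕ) (m : ℤ) (y : S2) : ℂ :=
  if 0 ≤ m then sphericalHarmonicNonneg l m.natAbs y
  else (-1) ^ m.natAbs * conj (sphericalHarmonicNonneg l m.natAbs y)

/-! ### The angular power spectrum -/

section Spectrum

variable {Ω : Type*} [MeasurableSpace Ω]

/-- The Karhunen–Loève coefficient `a_{ℓm} = ∫ T(y) conj Y_{ℓm}(y) dσ(y)`. -/
def klCoeff (T : Ω → S2 → ℝ) (l : ℕ) (m : ℤ) (ω : Ω) : ℂ :=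
  ∫ y, (T ω y : ℂ) * conj (sphericalHarmonic l m y) ∂surfaceMeasure

/-- The angular power spectrum `(A_ℓ)` of an isotropic random field. It is the sequence with
`E(a_{ℓm} conj a_{ℓ'm'}) = A_ℓ δ_{ℓℓ'} δ_{mm'}`, except that
`E(a_{00} conj a_{00}) = A_0 + (E a_{00})²`, and is read off here from the entries with
`(ℓ, m) = (ℓ', m') = (ℓ, 0)`; see `angularPowerSpectrum_eq`. -/
def angularPowerSpectrum (P : Measure Ω) (T : Ω → S2 → ℝ) (l : ℕ) : ℝ :=
  ((∫ ω, klCoeff T l 0 ω * conj (klCoeff T l 0 ω) ∂P) -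
    if l = 0 then (∫ ω, klCoeff T 0 0 ω ∂P) ^ 2 else 0).re

/-- Any sequence satisfying the covariance relations that characterise the angular power
spectrum is equal to `angularPowerSpectrum P T`. -/
theorem angularPowerSpectrum_eq (P : Measure Ω) (T : Ω → S2 → ℝ) (A : ℕ → ℝ)
    (h : ∀ (l₁ l₂ : ℕ) (m₁ m₂ : ℤ), 1 ≤ l₁ → 1 ≤ l₂ → |m₁| ≤ l₁ → |m₂| ≤ l₂ →
      ∫ ω, klCoeff T l₁ m₁ ω * conj (klCoeff T l₂ m₂ ω) ∂P =
        if l₁ = l₂ ∧ m₁ = m₂ then (A l₁ : ℂ) else 0)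
    (h₀ : ∀ (l : ℕ) (m : ℤ), |m| ≤ l →
      ∫ ω, klCoeff T 0 0 ω * conj (klCoeff T l m ω) ∂P =
        if l = 0 ∧ m = 0 then (A 0 : ℂ) + (∫ ω, klCoeff T 0 0 ω ∂P) ^ 2 else 0) :
    A = angularPowerSpectrum P T := by
  funext l
  rcases Nat.eq_zero_or_pos l with rfl | hl
  · have := h₀ 0 0 (by simp)
    simp [angularPowerSpectrum, this]
  · have := h l l 0 0 hl hl (by simp) (by simp)
    simp [angularPowerSpectrum, this, hl.ne']

end Spectrum

end SphereField

end

/-! Isotropy makes the mean of `T` constant, so the increments are centred Gaussians and all their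
moments are powers of their standard deviation. Once E(T(x) - T(y))² ≤ K dist(x, y)^β, the moment of
order m is at most a constant times dist(x, y)^(mβ/2) for every m, and Kolmogorov–Chentsov with
large m reaches every exponent below β/2.

For the variance, let κ (`covKernel`) be the uncentred covariance as a function of ⟨x, y⟩, so that
E(T(x) - T(y))² = 2(κ(1) - κ(⟨x, y⟩)). Formally κ = ∑ c_ℓ (2ℓ+1)/(4π) P_ℓ with c_ℓ = A_ℓ for ℓ ≥ 1,
and the term ℓ = 0, which carries the mean, cancels in the difference. Since 1 - P_ℓ(cos θ) is at
most 2 and at most ℓ(ℓ+1)θ²/4, it is at most 2(ℓθ)^β, and the sum is controlled by ∑ A_ℓ ℓ^(1+β) θ^β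
(`covKernel_sub_le`).

The formal expansion has to be replaced by a statement valid at every point, because κ is a priori
only bounded and measurable. Joint measurability closes the gap: almost every path is in L², so its
mean square oscillation at scale n, weighted by the polynomial bump (n+1)/(4π) ((1+t)/2)^n, tends to
0. Taking expectations gives an averaged continuity of κ at 1, and hence the convolutions of κ with
the bumps converge to κ everywhere (`tendsto_covKernel_convolution_bump`). Each such convolution is
a finite Legendre sum by `funk_hecke`.

Only zonal functions are needed; the addition theorem for spherical harmonics is not. Convolution by
a zonal kernel preserves polynomials of degree at most ℓ and is symmetric, so it preserves the
orthogonal complement of the lower degrees, which is spanned by P_ℓ. This yields Funk–Hecke and the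
reproducing property. The latter makes x ↦ P_ℓ(⟨·, x⟩) a map into L² with squared distances
proportional to 1 - P_ℓ(⟨x, y⟩), from which both bounds on 1 - P_ℓ follow. -/

noncomputable section

namespace SphereField

open Filter Topology
open scoped ENNReal NNReal Pointwise

/-! ### Continuous modifications -/

section Chaining

variable {S : Type*} [MetricSpace S] [DecidableEq S]

/-- A function whose increments along pairs of neighbouring net points decay geometrically has
limits along the nets, and the limit function is Hölder continuous. -/
theorem exists_holder_limit_of_net (hS : ∀ x y : S, dist x y ≤ 2) (N : ℕ → Finset S)
    (p : ℕ → S → S) (hpN : ∀ j x, p j x ∈ N j) (hp : ∀ j x, dist (p j x) x ≤ 2 * (1 / 2) ^ j)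
    (f : S → ℝ) {γ M : ℝ} (hγ : 0 < γ)
    (hf : ∀ j, ∀ u ∈ N j ∪ N (j + 1), ∀ v ∈ N j ∪ N (j + 1), dist u v ≤ 8 * (1 / 2) ^ j →
      |f u - f v| ≤ M * ((1 / 2 : ℝ) ^ γ) ^ j) :
    ∃ g : S → ℝ, (∀ x, Tendsto (fun j => f (p j x)) atTop (𝓝 (g x))) ∧
      ∃ C, 0 ≤ C ∧ ∀ x y, |g x - g y| ≤ C * dist x y ^ γ := by
  set r : ℝ := (1 / 2 : ℝ) ^ γ with hr
  have hr0 : 0 < r := by positivity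
  have hr1 : r < 1 := Real.rpow_lt_one (by norm_num) (by norm_num) hγ
  have hstep : ∀ x j, dist (f (p j x)) (f (p (j + 1) x)) ≤ M * r ^ j := by
    intro x j
    rw [Real.dist_eq]
    refine hf j _ (Finset.mem_union_left _ (hpN j x)) _ (Finset.mem_union_right _ (hpN _ x)) ?_
    have h1 := hp j x
    have h2 := hp (j + 1) x
    have h3 := dist_triangle_right (p j x) (p (j + 1) x) x
    have h4 : (0 : ℝ) < (1 / 2) ^ j := by positivity
    rw [pow_succ] at h2
    linarith
  have hlim : ∀ x, ∃ a, Tendsto (fun j => f (p j x)) atTop (𝓝 a) := fun x =>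
    cauchySeq_tendsto_of_complete (cauchySeq_of_le_geometric r M hr1 (hstep x))
  choose g hg using hlim
  have hgp : ∀ x j, dist (f (p j x)) (g x) ≤ M * r ^ j / (1 - r) := fun x j =>
    dist_le_of_le_geometric_of_tendsto r M hr1 (hstep x) (hg x) j
  refine ⟨g, hg, ?_⟩
  rcases isEmpty_or_nonempty S with hE | ⟨⟨x₀⟩⟩
  · exact ⟨0, le_rfl, fun x => isEmptyElim x⟩
  have hM : 0 ≤ M := by
    have := hstep x₀ 0
    have h' := dist_nonneg (x := f (p 0 x₀)) (y := f (p 1 x₀))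
    simp at this
    linarith
  have h1r : 0 < 1 - r := by linarith
  refine ⟨M * (2 / (1 - r) + 1), by positivity, fun x y => ?_⟩
  rcases eq_or_ne x y with rfl | hxy
  · simp [Real.zero_rpow hγ.ne']
  have hd : 0 < dist x y := dist_pos.2 hxy
  -- The scale j satisfies 2⁻ʲ < dist x y ≤ 2 · 2⁻ʲ. It exists because the diameter is at most 2,
  -- and it places `p j x` and `p j y` within 6 · 2⁻ʲ of each other.
  obtain ⟨j, hj1, hj2⟩ := exists_nat_pow_near_of_lt_one (x := dist x y / 2) (y := (1 / 2 : ℝ))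
    (by positivity) (by linarith [hS x y]) (by norm_num) (by norm_num)
  rw [pow_succ] at hj1
  have hA : |f (p j x) - f (p j y)| ≤ M * r ^ j := by
    refine hf j _ (Finset.mem_union_left _ (hpN j x)) _ (Finset.mem_union_left _ (hpN j y)) ?_
    have h1 := hp j x
    have h2 := hp j y
    have h3 := dist_triangle4_right (p j x) (p j y) x y
    linarith
  have hrj : r ^ j ≤ dist x y ^ γ := by
    rw [hr, ← Real.rpow_natCast, ← Real.rpow_mul (by norm_num), mul_comm, Real.rpow_mul (by norm_num),
      Real.rpow_natCast]
    exact Real.rpow_le_rpow (by positivity) (by linarith) hγ.le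
  have hx := hgp x j
  have hy := hgp y j
  rw [Real.dist_eq] at hx hy
  calc |g x - g y| ≤ |f (p j x) - g x| + |f (p j x) - f (p j y)| + |f (p j y) - g y| := by
        have e : g x - g y = -(f (p j x) - g x) + (f (p j x) - f (p j y)) + (f (p j y) - g y) := by
          ring
        rw [e]
        refine (abs_add_le _ _).trans (add_le_add (abs_add_le _ _) le_rfl) |>.trans ?_
        rw [abs_neg]
    _ ≤ M * r ^ j / (1 - r) + M * r ^ j + M * r ^ j / (1 - r) := by gcongr
    _ = M * (2 / (1 - r) + 1) * r ^ j := by ring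
    _ ≤ _ := by gcongr

variable {Ω : Type*} [MeasurableSpace Ω]

/-- Moment bounds on increments of a random field bound, almost surely, all increments along
neighbouring points of nets of polynomial cardinality. -/
theorem ae_exists_bound_net_increments (P : Measure Ω) (X : Ω → S → ℝ)
    (hX : ∀ x, Measurable fun ω => X ω x) {a : ℝ}
    (hmom : ∀ m : ℕ, ∃ C : ℝ≥0, ∀ x y, ∫⁻ ω, ‖X ω x - X ω y‖ₑ ^ m ∂P ≤
      C * ENNReal.ofReal ((dist x y ^ a) ^ m))
    (ha : 0 ≤ a) (N : ℕ → Finset S) {A B : ℕ} (hN : ∀ j, (N j ∪ N (j + 1)).card ≤ A * B ^ j)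
    {γ : ℝ} (hγ : γ < a) :
    ∀ᵐ ω ∂P, ∃ M : ℝ, ∀ j, ∀ u ∈ N j ∪ N (j + 1), ∀ v ∈ N j ∪ N (j + 1),
      dist u v ≤ 8 * (1 / 2) ^ j → |X ω u - X ω v| ≤ M * ((1 / 2 : ℝ) ^ γ) ^ j := by
  set r : ℝ := (1 / 2 : ℝ) ^ γ with hr
  set s : ℝ := (1 / 2 : ℝ) ^ a with hs
  have hr0 : 0 < r := by positivity
  have hs0 : 0 < s := by positivity
  have hsr : s / r < 1 := by
    rw [div_lt_one hr0]
    exact Real.rpow_lt_rpow_of_exponent_gt (by norm_num) (by norm_num) hγ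
  -- The number of pairs at level j grows at most like B^(2j), while a normalised moment of order n
  -- decays like (s/r)^(nj). A large order makes the product summable; passing to m + 1 keeps the
  -- order positive, so that n-th roots can be taken at the end.
  obtain ⟨m, hm⟩ := exists_pow_lt_of_lt_one (y := s / r) (x := 1 / ((B : ℝ) ^ 2 + 1))
    (by positivity) hsr
  obtain ⟨C, hC⟩ := hmom (m + 1)
  set n := m + 1 with hn
  have hn' : (s / r) ^ n * (B : ℝ) ^ 2 < 1 := by
    have h0 : (s / r) ^ n ≤ (s / r) ^ m := by
      rw [hn, pow_succ]
      exact mul_le_of_le_one_right (by positivity) hsr.le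
    have : (s / r) ^ n < 1 / ((B : ℝ) ^ 2 + 1) := h0.trans_lt hm
    rw [lt_div_iff₀ (by positivity)] at this
    have h2 : 0 < (s / r) ^ n := by positivity
    linarith
  let Q : ℕ → Finset (S × S) := fun j =>
    ((N j ∪ N (j + 1)) ×ˢ (N j ∪ N (j + 1))).filter fun w => dist w.1 w.2 ≤ 8 * (1 / 2) ^ j
  -- The sum of all n-th powers of net increments normalised by r^j. It has finite expectation, and
  -- its n-th root dominates every normalised increment.
  let Z : Ω → ℝ≥0∞ := fun ω => ∑' j, ∑ w ∈ Q j,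
    ‖X ω w.1 - X ω w.2‖ₑ ^ n * ENNReal.ofReal (((r ^ j) ^ n)⁻¹)
  have hmeas : ∀ w : S × S, Measurable fun ω => ‖X ω w.1 - X ω w.2‖ₑ ^ n := fun w =>
    ((hX w.1).sub (hX w.2)).enorm.pow_const n
  have hZm : Measurable Z := Measurable.tsum fun j => Finset.measurable_sum _ fun w _ =>
    (hmeas w).mul_const _
  have hZ : ∫⁻ ω, Z ω ∂P ≠ ∞ := by
    have hterm : ∀ j, ∫⁻ ω, ∑ w ∈ Q j, ‖X ω w.1 - X ω w.2‖ₑ ^ n *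
        ENNReal.ofReal (((r ^ j) ^ n)⁻¹) ∂P ≤
        C * ENNReal.ofReal ((A : ℝ) ^ 2 * (8 ^ a) ^ n * ((s / r) ^ n * (B : ℝ) ^ 2) ^ j) := by
      intro j
      rw [lintegral_finsetSum _ fun w _ => (hmeas w).mul_const _]
      have hb : ∀ w ∈ Q j, ∫⁻ ω, ‖X ω w.1 - X ω w.2‖ₑ ^ n * ENNReal.ofReal (((r ^ j) ^ n)⁻¹) ∂P ≤
          C * ENNReal.ofReal ((8 ^ a) ^ n * ((s / r) ^ n) ^ j) := by
        intro w hw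
        rw [lintegral_mul_const _ (hmeas w)]
        have hw' := (Finset.mem_filter.1 hw).2
        calc _ ≤ C * ENNReal.ofReal ((dist w.1 w.2 ^ a) ^ n) * ENNReal.ofReal (((r ^ j) ^ n)⁻¹) := by
              gcongr; exact hC _ _
          _ = C * ENNReal.ofReal ((dist w.1 w.2 ^ a) ^ n * ((r ^ j) ^ n)⁻¹) := by
              rw [mul_assoc, ENNReal.ofReal_mul (by positivity)]
          _ ≤ _ := by
              refine mul_le_mul' le_rfl (ENNReal.ofReal_le_ofReal ?_)
              have h1 : dist w.1 w.2 ^ a ≤ 8 ^ a * s ^ j := by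
                refine (Real.rpow_le_rpow dist_nonneg hw' ha).trans_eq ?_
                rw [Real.mul_rpow (by norm_num) (by positivity), hs, ← Real.rpow_natCast,
                  ← Real.rpow_natCast, ← Real.rpow_mul (by norm_num), ← Real.rpow_mul (by norm_num),
                  mul_comm a]
              calc (dist w.1 w.2 ^ a) ^ n * ((r ^ j) ^ n)⁻¹
                  ≤ (8 ^ a * s ^ j) ^ n * ((r ^ j) ^ n)⁻¹ := by gcongr
                _ = _ := by rw [mul_pow, div_pow, div_pow, ← pow_mul, ← pow_mul, ← pow_mul,
                    ← pow_mul, mul_comm j n]; ring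
      refine (Finset.sum_le_card_nsmul _ _ _ hb).trans ?_
      rw [nsmul_eq_mul]
      have hcard : ((Q j).card : ℝ≥0∞) ≤ ENNReal.ofReal ((A * (B : ℝ) ^ j) ^ 2) := by
        have : (Q j).card ≤ (A * B ^ j) ^ 2 := by
          refine (Finset.card_filter_le _ _).trans ?_
          rw [Finset.card_product, sq]
          exact Nat.mul_le_mul (hN j) (hN j)
        calc ((Q j).card : ℝ≥0∞) ≤ (((A * B ^ j) ^ 2 : ℕ) : ℝ≥0∞) := by exact_mod_cast this
          _ = _ := by rw [← ENNReal.ofReal_natCast]; push_cast; rfl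
      calc _ ≤ ENNReal.ofReal ((A * (B : ℝ) ^ j) ^ 2) *
            (C * ENNReal.ofReal ((8 ^ a) ^ n * ((s / r) ^ n) ^ j)) := by gcongr
        _ = C * ENNReal.ofReal ((A * (B : ℝ) ^ j) ^ 2 * ((8 ^ a) ^ n * ((s / r) ^ n) ^ j)) := by
            rw [ENNReal.ofReal_mul (p := (A * (B : ℝ) ^ j) ^ 2) (by positivity)]; ring
        _ = _ := by
            congr 2
            rw [mul_pow, mul_pow, ← pow_mul, ← pow_mul, mul_comm j 2]; ring
    rw [show Z = fun ω => ∑' j, ∑ w ∈ Q j,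
      ‖X ω w.1 - X ω w.2‖ₑ ^ n * ENNReal.ofReal (((r ^ j) ^ n)⁻¹) from rfl,
      lintegral_tsum fun j => (Finset.measurable_sum _ fun w _ =>
        (hmeas w).mul_const _).aemeasurable]
    refine ne_top_of_le_ne_top ?_ (ENNReal.tsum_le_tsum hterm)
    rw [ENNReal.tsum_mul_left]
    refine ENNReal.mul_ne_top ENNReal.coe_ne_top ?_
    rw [← ENNReal.ofReal_tsum_of_nonneg (fun j => by positivity)]
    · exact ENNReal.ofReal_ne_top
    · exact (summable_geometric_of_lt_one (by positivity) hn').mul_left _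
  filter_upwards [ae_lt_top hZm hZ] with ω hω
  refine ⟨(Z ω).toReal ^ ((n : ℝ)⁻¹), fun j u hu v hv huv => ?_⟩
  have h1 : ‖X ω u - X ω v‖ₑ ^ n * ENNReal.ofReal (((r ^ j) ^ n)⁻¹) ≤ Z ω := by
    refine le_trans ?_ (ENNReal.le_tsum j)
    exact Finset.single_le_sum (f := fun w : S × S =>
      ‖X ω w.1 - X ω w.2‖ₑ ^ n * ENNReal.ofReal (((r ^ j) ^ n)⁻¹)) (fun _ _ => zero_le)
      (Finset.mem_filter.2 ⟨Finset.mk_mem_product hu hv, huv⟩ : (u, v) ∈ Q j)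
  have h2 : |X ω u - X ω v| ^ n * ((r ^ j) ^ n)⁻¹ ≤ (Z ω).toReal := by
    have := ENNReal.toReal_mono hω.ne h1
    rwa [ENNReal.toReal_mul, ENNReal.toReal_pow, ENNReal.toReal_ofReal (by positivity),
      toReal_enorm, Real.norm_eq_abs] at this
  have h3 : (|X ω u - X ω v| * (r ^ j)⁻¹) ^ n ≤ ((Z ω).toReal ^ ((n : ℝ)⁻¹)) ^ n := by
    rw [mul_pow, inv_pow, Real.rpow_inv_natCast_pow ENNReal.toReal_nonneg (by omega)]
    exact h2
  have h4 := le_of_pow_le_pow_left₀ (by omega) (by positivity) h3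
  rwa [← div_eq_mul_inv, div_le_iff₀ (by positivity)] at h4

/-- **Kolmogorov–Chentsov** on a metric space with nets of polynomial cardinality, for a field
with increments of all orders controlled. -/
theorem exists_holder_modification_of_net (hS : ∀ x y : S, dist x y ≤ 2) (N : ℕ → Finset S)
    (p : ℕ → S → S) (hpN : ∀ j x, p j x ∈ N j) (hp : ∀ j x, dist (p j x) x ≤ 2 * (1 / 2) ^ j)
    {A B : ℕ} (hN : ∀ j, (N j ∪ N (j + 1)).card ≤ A * B ^ j)
    (P : Measure Ω) (X : Ω → S → ℝ) (hX : ∀ x, Measurable fun ω => X ω x) {a : ℝ} (ha : 0 < a)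
    (hmom : ∀ m : ℕ, ∃ C : ℝ≥0, ∀ x y, ∫⁻ ω, ‖X ω x - X ω y‖ₑ ^ m ∂P ≤
      C * ENNReal.ofReal ((dist x y ^ a) ^ m)) :
    ∃ Y : Ω → S → ℝ, (∀ x, Measurable fun ω => Y ω x) ∧ (∀ x, ∀ᵐ ω ∂P, Y ω x = X ω x) ∧
      ∀ ω γ, 0 < γ → γ < a → ∃ C, 0 ≤ C ∧ ∀ x y, |Y ω x - Y ω y| ≤ C * dist x y ^ γ := by
  -- Rational exponents suffice and leave a single null set for all γ.
  have hae : ∀ᵐ ω ∂P, ∀ q : ℚ, (q : ℝ) < a → ∃ M : ℝ, ∀ j, ∀ u ∈ N j ∪ N (j + 1),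
      ∀ v ∈ N j ∪ N (j + 1),
      dist u v ≤ 8 * (1 / 2) ^ j → |X ω u - X ω v| ≤ M * ((1 / 2 : ℝ) ^ (q : ℝ)) ^ j := by
    rw [ae_all_iff]
    intro q
    by_cases hq : (q : ℝ) < a
    · filter_upwards [ae_exists_bound_net_increments P X hX hmom ha.le N hN hq] with ω h _ using h
    · exact Eventually.of_forall fun ω h => absurd h hq
  obtain ⟨G, hGm, hGae, hG⟩ : ∃ G : Set Ω, MeasurableSet G ∧ (∀ᵐ ω ∂P, ω ∈ G) ∧ ∀ ω ∈ G,
      ∀ q : ℚ, (q : ℝ) < a → ∃ M : ℝ, ∀ j, ∀ u ∈ N j ∪ N (j + 1), ∀ v ∈ N j ∪ N (j + 1),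
      dist u v ≤ 8 * (1 / 2) ^ j → |X ω u - X ω v| ≤ M * ((1 / 2 : ℝ) ^ (q : ℝ)) ^ j := by
    obtain ⟨t, ht, htm, ht0⟩ := exists_measurable_superset_of_null hae
    refine ⟨tᶜ, htm.compl, ?_, fun ω hω => ?_⟩
    · rw [ae_iff]; simpa using ht0
    · by_contra h
      exact hω (ht h)
  have key : ∀ ω ∈ G, ∀ γ, 0 < γ → γ < a → ∃ g : S → ℝ,
      (∀ x, Tendsto (fun j => X ω (p j x)) atTop (𝓝 (g x))) ∧
      ∃ C, 0 ≤ C ∧ ∀ x y, |g x - g y| ≤ C * dist x y ^ γ := by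
    intro ω hω γ hγ hγa
    obtain ⟨q, hq1, hq2⟩ := exists_rat_btwn hγa
    obtain ⟨M, hM⟩ := hG ω hω q hq2
    refine exists_holder_limit_of_net hS N p hpN hp (X ω) hγ (M := |M|)
      fun j u hu v hv huv => (hM j u hu v hv huv).trans ?_
    have : (1 / 2 : ℝ) ^ (q : ℝ) ≤ (1 / 2 : ℝ) ^ γ :=
      Real.rpow_le_rpow_of_exponent_ge (by norm_num) (by norm_num) hq1.le
    gcongr
    exact le_abs_self M
  have key' : ∀ ω, ∃ g : S → ℝ, (ω ∈ G → ∀ x, Tendsto (fun j => X ω (p j x)) atTop (𝓝 (g x))) ∧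
      (ω ∉ G → g = 0) ∧
      ∀ γ, 0 < γ → γ < a → ∃ C, 0 ≤ C ∧ ∀ x y, |g x - g y| ≤ C * dist x y ^ γ := by
    intro ω
    by_cases hω : ω ∈ G
    · obtain ⟨g, hg, -⟩ := key ω hω (a / 2) (by linarith) (by linarith)
      refine ⟨g, fun _ => hg, fun h => absurd hω h, fun γ h1 h2 => ?_⟩
      obtain ⟨g', hg', hC⟩ := key ω hω γ h1 h2
      -- The limit along the nets does not depend on γ, so one path serves all exponents.
      have : g = g' := funext fun x => tendsto_nhds_unique (hg x) (hg' x)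
      rwa [this]
    -- Off the good event the path is set to zero, so regularity holds for every ω and not only
    -- almost surely.
    · exact ⟨0, fun h => absurd h hω, fun _ => rfl, fun γ _ _ => ⟨0, le_rfl, by simp⟩⟩
  choose Y hY1 hY0 hY2 using key'
  refine ⟨Y, fun x => ?_, fun x => ?_, hY2⟩
  · refine measurable_of_tendsto_metrizable (f := fun j => G.indicator fun ω => X ω (p j x))
      (fun j => (hX _).indicator hGm) ?_
    rw [tendsto_pi_nhds]
    intro ω
    by_cases hω : ω ∈ G
    · simpa [hω] using hY1 ω hω x
    · simp [hω, hY0 ω hω]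
  · obtain ⟨C, hC⟩ := hmom 1
    have hYm : Measurable fun ω => X ω x := hX x
    -- Fatou: X(p j x) tends to X(x) in L¹ because p j x tends to x, while it tends to Y(x) on the
    -- good event. Hence Y(x) = X(x) almost surely.
    have h0 : ∫⁻ ω, liminf (fun j => ‖X ω (p j x) - X ω x‖ₑ ^ 1) atTop ∂P ≤ 0 := by
      refine (lintegral_liminf_le fun j => ((hX _).sub (hX x)).enorm.pow_const 1).trans ?_
      have hb : ∀ j, ∫⁻ ω, ‖X ω (p j x) - X ω x‖ₑ ^ 1 ∂P ≤
          C * ENNReal.ofReal (((2 * (1 / 2) ^ j) ^ a) ^ 1) := fun j =>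
        (hC _ _).trans (by gcongr; exact hp j x)
      have ht : Tendsto (fun j : ℕ => C * ENNReal.ofReal (((2 * (1 / 2 : ℝ) ^ j) ^ a) ^ 1)) atTop
          (𝓝 (C * ENNReal.ofReal (((2 * 0) ^ a) ^ 1))) := by
        refine ENNReal.Tendsto.const_mul (ENNReal.tendsto_ofReal ?_) (Or.inr ENNReal.coe_ne_top)
        refine Tendsto.pow ?_ 1
        exact ((tendsto_pow_atTop_nhds_zero_of_lt_one (by norm_num) (by norm_num)).const_mul
          (2 : ℝ)).rpow_const (Or.inr ha.le)
      simp only [mul_zero, Real.zero_rpow ha.ne', pow_one, ENNReal.ofReal_zero] at ht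
      have h2 := tendsto_of_tendsto_of_tendsto_of_le_of_le tendsto_const_nhds ht
        (fun j => zero_le) (fun j => by simpa using hb j)
      simpa using h2.liminf_eq.le
    have h1 := (lintegral_eq_zero_iff (Measurable.liminf fun j =>
      ((hX _).sub (hX x)).enorm.pow_const 1)).1 (le_antisymm h0 zero_le)
    filter_upwards [h1, hGae] with ω hω hωG
    have ht : Tendsto (fun j => ‖X ω (p j x) - X ω x‖ₑ ^ 1) atTop (𝓝 (‖Y ω x - X ω x‖ₑ)) := by
      simp only [pow_one]
      exact ((hY1 ω hωG x).sub_const _).enorm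
    have h3 : ‖Y ω x - X ω x‖ₑ = 0 := ht.liminf_eq.symm.trans hω
    rwa [enorm_eq_zero, sub_eq_zero] at h3

end Chaining

/-! ### Chordal and geodesic distance; nets on the sphere -/

lemma inner_mem_Icc (x y : S2) : inner ℝ (x : E3) (y : E3) ∈ Set.Icc (-1 : ℝ) 1 := by
  have h := abs_real_inner_le_norm (x : E3) (y : E3)
  rw [norm_eq_of_mem_sphere, norm_eq_of_mem_sphere, mul_one] at h
  exact abs_le.1 h

lemma dist_sq_eq (x y : S2) : dist x y ^ 2 = 2 - 2 * inner ℝ (x : E3) (y : E3) := by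
  rw [Subtype.dist_eq, dist_eq_norm, norm_sub_sq_real, norm_eq_of_mem_sphere,
    norm_eq_of_mem_sphere]
  ring

lemma inner_self_sphere (x : S2) : inner ℝ (x : E3) (x : E3) = 1 := by
  rw [real_inner_self_eq_norm_sq, norm_eq_of_mem_sphere, one_pow]

lemma cos_geodesicDist (x y : S2) :
    Real.cos (geodesicDist x y) = inner ℝ (x : E3) (y : E3) :=
  Real.cos_arccos (inner_mem_Icc x y).1 (inner_mem_Icc x y).2

lemma geodesicDist_nonneg (x y : S2) : 0 ≤ geodesicDist x y := Real.arccos_nonneg _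

lemma dist_le_geodesicDist (x y : S2) : dist x y ≤ geodesicDist x y := by
  refine le_of_sq_le_sq ?_ (geodesicDist_nonneg x y)
  have := Real.one_sub_sq_div_two_le_cos (x := geodesicDist x y)
  rw [cos_geodesicDist] at this
  rw [dist_sq_eq]
  linarith

/-- The chord of an arc θ has length 2 sin(θ/2), and Jordan's inequality bounds the sine from below
by 2/π times the angle on [0, π/2]. -/
lemma geodesicDist_le_mul_dist (x y : S2) : geodesicDist x y ≤ Real.pi / 2 * dist x y := by
  set θ := geodesicDist x y with hθ
  have h0 : 0 ≤ θ := geodesicDist_nonneg x y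
  have hpi : θ ≤ Real.pi := Real.arccos_le_pi _
  have h1 : 2 / Real.pi * (θ / 2) ≤ Real.sin (θ / 2) :=
    Real.mul_le_sin (by linarith) (by linarith)
  have h2 : dist x y ^ 2 = (2 * Real.sin (θ / 2)) ^ 2 := by
    rw [dist_sq_eq, ← cos_geodesicDist, ← hθ, show θ = 2 * (θ / 2) by ring, Real.cos_two_mul,
      mul_pow, Real.sin_sq]
    ring_nf
  have h3 : dist x y = 2 * Real.sin (θ / 2) := by
    have : 0 ≤ Real.sin (θ / 2) := Real.sin_nonneg_of_nonneg_of_le_pi (by linarith) (by linarith)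
    exact (pow_left_inj₀ dist_nonneg (by linarith) two_ne_zero).1 h2
  rw [h3]
  have hp := Real.pi_pos
  have : Real.pi / 2 * (2 * (2 / Real.pi * (θ / 2))) = θ := by field_simp
  nlinarith

lemma dist_le_two_sphere (x y : S2) : dist x y ≤ 2 := by
  refine le_of_sq_le_sq ?_ two_pos.le
  rw [dist_sq_eq]
  linarith [(inner_mem_Icc x y).1]

/-- The cell of the cubic grid of mesh `2⁻ʲ` that contains a point of the sphere. -/
def gridCell (j : ℕ) (x : S2) : Fin 3 → ℤ := fun i => ⌊(2 : ℝ) ^ j * (x : E3) i⌋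

/-- Each coordinate differs by at most 2⁻ʲ, and √3 ≤ 2. -/
lemma dist_le_of_gridCell_eq {j : ℕ} {x y : S2} (h : gridCell j x = gridCell j y) :
    dist x y ≤ 2 * (1 / 2) ^ j := by
  have h2 : ∀ i, ((x : E3) i - (y : E3) i) ^ 2 ≤ ((1 / 2 : ℝ) ^ j) ^ 2 := by
    intro i
    have h1 := Int.abs_sub_lt_one_of_floor_eq_floor (congrFun h i)
    rw [← mul_sub, abs_mul, abs_of_pos (by positivity)] at h1
    rw [sq_le_sq, abs_of_pos (a := (1 / 2 : ℝ) ^ j) (by positivity), one_div, inv_pow,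
      ← one_div, le_div_iff₀ (by positivity), mul_comm]
    exact h1.le
  refine le_of_sq_le_sq ?_ (by positivity)
  rw [Subtype.dist_eq, EuclideanSpace.dist_eq, Real.sq_sqrt (by positivity)]
  simp only [Real.dist_eq, sq_abs, Fin.sum_univ_three]
  have := sq_nonneg ((1 / 2 : ℝ) ^ j)
  rw [mul_pow]
  linarith [h2 0, h2 1, h2 2]

lemma gridCell_mem (j : ℕ) (x : S2) :
    gridCell j x ∈ Fintype.piFinset fun _ : Fin 3 => Finset.Icc (-(2 : ℤ) ^ j) ((2 : ℤ) ^ j) := by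
  rw [Fintype.mem_piFinset]
  intro i
  have h1 : |(x : E3) i| ≤ 1 := by
    have := PiLp.norm_apply_le (x : E3) i
    rwa [norm_eq_of_mem_sphere, Real.norm_eq_abs] at this
  have h2 : (0 : ℝ) < 2 ^ j := by positivity
  rw [abs_le] at h1
  rw [Finset.mem_Icc, gridCell, Int.le_floor]
  constructor
  · push_cast; nlinarith
  · have : ((⌊(2 : ℝ) ^ j * (x : E3) i⌋ : ℤ) : ℝ) ≤ 2 ^ j := (Int.floor_le _).trans (by nlinarith)
    exact_mod_cast this

/-- One representative is chosen in each grid cell that meets the sphere. There are at most (3 ·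
2ʲ)³ = 27 · 8ʲ cells at level j, and 243 = 27 + 27 · 8 accounts for two consecutive levels. -/
theorem exists_sphere_nets [DecidableEq S2] : ∃ (N : ℕ → Finset S2) (p : ℕ → S2 → S2),
    (∀ j x, p j x ∈ N j) ∧ (∀ j x, dist (p j x) x ≤ 2 * (1 / 2) ^ j) ∧
    ∀ j, (N j ∪ N (j + 1)).card ≤ 243 * 8 ^ j := by
  have hex : ∃ x : S2, True := ⟨⟨EuclideanSpace.single 0 1, by simp⟩, trivial⟩
  have : Nonempty S2 := ⟨hex.choose⟩
  let N : ℕ → Finset S2 := fun j =>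
    (Fintype.piFinset fun _ : Fin 3 => Finset.Icc (-(2 : ℤ) ^ j) ((2 : ℤ) ^ j)).image
      (Function.invFun (gridCell j))
  refine ⟨N, fun j x => Function.invFun (gridCell j) (gridCell j x), fun j x =>
    Finset.mem_image_of_mem _ (gridCell_mem j x), fun j x =>
    dist_le_of_gridCell_eq (Function.invFun_eq ⟨x, rfl⟩), fun j => ?_⟩
  have hc : ∀ j, (N j).card ≤ 27 * 8 ^ j := by
    intro j
    refine Finset.card_image_le.trans ?_
    have h1 : (1 : ℕ) ≤ 2 ^ j := Nat.one_le_two_pow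
    have h2 : ((2 : ℤ) ^ j + 1 - -2 ^ j).toNat ≤ 3 * 2 ^ j := by
      have : ((2 : ℤ) ^ j) = ((2 ^ j : ℕ) : ℤ) := by push_cast; rfl
      rw [this]; omega
    simp only [Fintype.card_piFinset, Int.card_Icc, Finset.prod_const, Finset.card_univ,
      Fintype.card_fin]
    calc _ ≤ (3 * 2 ^ j) ^ 3 := Nat.pow_le_pow_left h2 3
      _ = 27 * 8 ^ j := by rw [mul_pow, ← pow_mul, mul_comm j 3, pow_mul]; norm_num
  refine (Finset.card_union_le _ _).trans ((add_le_add (hc j) (hc (j + 1))).trans_eq ?_)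
  rw [pow_succ]; ring

/-- **Kolmogorov–Chentsov** on the sphere, for a field with increments of all orders
controlled. -/
theorem exists_holder_modification {Ω : Type*} [MeasurableSpace Ω] (P : Measure Ω) (X : Ω → S2 → ℝ)
    (hX : ∀ x, Measurable fun ω => X ω x) {a : ℝ} (ha : 0 < a)
    (hmom : ∀ m : ℕ, ∃ C : ℝ≥0, ∀ x y, ∫⁻ ω, ‖X ω x - X ω y‖ₑ ^ m ∂P ≤
      C * ENNReal.ofReal ((dist x y ^ a) ^ m)) :
    ∃ Y : Ω → S2 → ℝ, IsRandomField Y ∧ IsModificationOf P Y X ∧ (∀ ω, Continuous (Y ω)) ∧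
      ∀ ω γ, 0 < γ → γ < a → IsHolder γ (Y ω) := by
  classical
  obtain ⟨N, p, hpN, hp, hN⟩ := exists_sphere_nets
  obtain ⟨Y, hYm, hYX, hY⟩ := exists_holder_modification_of_net dist_le_two_sphere N p hpN hp hN
    P X hX ha hmom
  have hcont : ∀ ω, Continuous (Y ω) := by
    intro ω
    obtain ⟨C, hC0, hC⟩ := hY ω (a / 2) (by linarith) (by linarith)
    rw [continuous_iff_continuousAt]
    intro x
    rw [ContinuousAt, tendsto_iff_dist_tendsto_zero]
    have h1 : Tendsto (fun y => C * dist y x ^ (a / 2)) (𝓝 x) (𝓝 (C * 0 ^ (a / 2))) := by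
      refine Tendsto.const_mul _ (Tendsto.rpow_const ?_ (Or.inr (by linarith)))
      exact (continuous_id.dist continuous_const).tendsto' x 0 (dist_self x)
    rw [Real.zero_rpow (by linarith), mul_zero] at h1
    exact squeeze_zero (fun _ => dist_nonneg) (fun y => by rw [Real.dist_eq]; exact hC y x) h1
  refine ⟨Y, ?_, hYX, hcont, fun ω γ h1 h2 => ?_⟩
  -- A Carathéodory function, continuous in the point and measurable in ω, is jointly measurable.
  · have := measurable_uncurry_of_continuous_of_measurable (u := fun x ω => Y ω x)
      (fun ω => hcont ω) hYm
    exact this.comp measurable_swap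
  · obtain ⟨C, hC0, hC⟩ := hY ω γ h1 h2
    refine ⟨C, fun x y => (hC x y).trans ?_⟩
    have := dist_le_geodesicDist x y
    gcongr

/-! ### Isometries of the sphere and the surface measure -/

lemma norm_sub_inner_smul_sq (x y : S2) :
    ‖(y : E3) - inner ℝ (x : E3) (y : E3) • (x : E3)‖ ^ 2 = 1 - inner ℝ (x : E3) (y : E3) ^ 2 := by
  rw [norm_sub_sq_real, norm_smul, inner_smul_right, norm_eq_of_mem_sphere, norm_eq_of_mem_sphere,
    real_inner_comm, Real.norm_eq_abs, mul_one, sq_abs]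
  ring

/-- An orthonormal frame adapted to two points of the sphere. -/
theorem exists_adapted_frame (x y : S2) : ∃ b : OrthonormalBasis (Fin 3) ℝ E3, b 0 = x ∧
    (y : E3) = inner ℝ (x : E3) (y : E3) • (x : E3) +
      Real.sqrt (1 - inner ℝ (x : E3) (y : E3) ^ 2) • b 1 := by
  set t := inner ℝ (x : E3) (y : E3) with ht
  have hcard : Module.finrank ℝ E3 = Fintype.card (Fin 3) := by simp
  have hn := norm_sub_inner_smul_sq x y
  rw [← ht] at hn
  have hs : Real.sqrt (1 - t ^ 2) = ‖(y : E3) - t • (x : E3)‖ := by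
    rw [← hn, Real.sqrt_sq (norm_nonneg _)]
  rw [hs]
  -- If y = ±x the square root vanishes, and any completion of x to an orthonormal basis will do.
  by_cases h0 : (y : E3) - t • (x : E3) = 0
  · obtain ⟨b, hb⟩ := Orthonormal.exists_orthonormalBasis_extension_of_card_eq (𝕜 := ℝ)
      (v := fun _ : Fin 3 => (x : E3)) (s := {0}) hcard
      (by
        rw [orthonormal_iff_ite]
        rintro ⟨i, hi⟩ ⟨j, hj⟩
        obtain rfl := Set.mem_singleton_iff.1 hi
        obtain rfl := Set.mem_singleton_iff.1 hj
        simp)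
    refine ⟨b, hb 0 rfl, ?_⟩
    rw [h0, norm_zero, zero_smul, add_zero]
    exact sub_eq_zero.1 h0
  · set w := (y : E3) - t • (x : E3) with hw
    have hw0 : ‖w‖ ≠ 0 := norm_ne_zero_iff.2 h0
    have hxw : inner ℝ (x : E3) w = 0 := by
      rw [hw, inner_sub_right, inner_smul_right, inner_self_sphere, ← ht]; ring
    obtain ⟨b, hb⟩ := Orthonormal.exists_orthonormalBasis_extension_of_card_eq (𝕜 := ℝ)
      (v := ![(x : E3), ‖w‖⁻¹ • w, 0]) (s := {0, 1}) hcard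
      (by
        rw [orthonormal_iff_ite]
        rintro ⟨i, hi⟩ ⟨j, hj⟩
        have hww : inner ℝ (‖w‖⁻¹ • w) (‖w‖⁻¹ • w) = (1 : ℝ) := by
          rw [inner_smul_left, inner_smul_right, real_inner_self_eq_norm_sq]
          simp only [conj_trivial]
          field_simp
        have hwx : inner ℝ w (x : E3) = 0 := by rw [real_inner_comm, hxw]
        rcases hi with rfl | hi <;> rcases hj with rfl | hj
        · simp
        · obtain rfl := Set.mem_singleton_iff.1 hj
          simp [inner_smul_right, hxw, Subtype.ext_iff]
        · obtain rfl := Set.mem_singleton_iff.1 hi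
          simp [inner_smul_left, hwx, Subtype.ext_iff]
        · obtain rfl := Set.mem_singleton_iff.1 hi
          obtain rfl := Set.mem_singleton_iff.1 hj
          simpa using hww)
    refine ⟨b, hb 0 (by simp), ?_⟩
    rw [hb 1 (by simp)]
    simp only [Matrix.cons_val_one, Matrix.cons_val_zero]
    rw [smul_smul, mul_inv_cancel₀ hw0, one_smul, hw]
    abel

lemma inner_rotate (g : E3 ≃ₗᵢ[ℝ] E3) (x y : S2) :
    inner ℝ (rotate g x : E3) (rotate g y : E3) = inner ℝ (x : E3) (y : E3) :=
  g.inner_map_map _ _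

/-- The rotations act transitively on pairs of points at a given distance. -/
theorem exists_rotation_of_inner_eq {x y x' y' : S2}
    (h : inner ℝ (x : E3) (y : E3) = inner ℝ (x' : E3) (y' : E3)) :
    ∃ g : E3 ≃ₗᵢ[ℝ] E3, IsRotation g ∧ rotate g x = x' ∧ rotate g y = y' := by
  obtain ⟨b, hb0, hb1⟩ := exists_adapted_frame x y
  obtain ⟨c, hc0, hc1⟩ := exists_adapted_frame x' y'
  have main : ∀ f : E3 ≃ₗᵢ[ℝ] E3, f (c 0) = c 0 → f (c 1) = c 1 →
      rotate ((b.equiv c (Equiv.refl _)).trans f) x = x' ∧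
      rotate ((b.equiv c (Equiv.refl _)).trans f) y = y' := by
    intro f h0 h1
    have e0 : f ((b.equiv c (Equiv.refl _)) (x : E3)) = x' := by
      rw [← hb0, OrthonormalBasis.equiv_apply_basis, Equiv.refl_apply, h0, hc0]
    refine ⟨Subtype.ext e0, Subtype.ext ?_⟩
    change f ((b.equiv c (Equiv.refl _)) (y : E3)) = y'
    rw [hb1, map_add, map_add, map_smul, map_smul, map_smul, map_smul, e0,
      OrthonormalBasis.equiv_apply_basis, Equiv.refl_apply, h1, h, ← hc1]
  have hdet : LinearMap.det ((b.equiv c (Equiv.refl _)).toLinearEquiv : E3 →ₗ[ℝ] E3) = 1 ∨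
      LinearMap.det ((b.equiv c (Equiv.refl _)).toLinearEquiv : E3 →ₗ[ℝ] E3) = -1 := by
    have h1 := b.toBasis.det_comp ((b.equiv c (Equiv.refl _)).toLinearEquiv : E3 →ₗ[ℝ] E3) b
    have h2 : b.toBasis.det b = 1 := by
      have := b.toBasis.det_self
      rwa [b.coe_toBasis] at this
    have h3 : (((b.equiv c (Equiv.refl _)).toLinearEquiv : E3 →ₗ[ℝ] E3) ∘ b) = c := by
      funext i
      simp
    rw [h2, mul_one, h3] at h1
    rw [← h1]
    exact b.det_to_matrix_orthonormalBasis_real c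
  rcases hdet with hd | hd
  · refine ⟨_, ?_, main (LinearIsometryEquiv.refl ℝ E3) rfl rfl⟩
    rw [IsRotation, ← hd]
    rfl
  -- The two points lie in the span of the first two frame vectors. Reflecting the third one
  -- corrects the determinant without moving them.
  · set f := (ℝ ∙ c 2)ᗮ.reflection with hf
    have hfix : ∀ i, i ≠ 2 → f (c i) = c i := fun i hi =>
      Submodule.reflection_mem_subspace_eq_self (Submodule.mem_orthogonal_singleton_iff_inner_right.2
        (c.orthonormal.2 hi.symm))
    refine ⟨_, ?_, main f (hfix 0 (by decide)) (hfix 1 (by decide))⟩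
    have hfd : LinearMap.det (f.toLinearEquiv : E3 →ₗ[ℝ] E3) = -1 := by
      have := (ℝ ∙ c 2)ᗮ.det_reflection
      rw [Submodule.orthogonal_orthogonal, finrank_span_singleton
        (by simpa using c.orthonormal.ne_zero 2), pow_one] at this
      exact this
    have : (((b.equiv c (Equiv.refl _)).trans f).toLinearEquiv : E3 →ₗ[ℝ] E3) =
        (f.toLinearEquiv : E3 →ₗ[ℝ] E3) ∘ₗ
          ((b.equiv c (Equiv.refl _)).toLinearEquiv : E3 →ₗ[ℝ] E3) := rfl
    rw [IsRotation, this, LinearMap.det_comp, hfd, hd]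
    norm_num

lemma continuous_rotate (g : E3 ≃ₗᵢ[ℝ] E3) : Continuous (rotate g) :=
  (g.continuous.comp continuous_subtype_val).subtype_mk _

lemma rotate_symm_rotate (g : E3 ≃ₗᵢ[ℝ] E3) (x : S2) : rotate g.symm (rotate g x) = x :=
  Subtype.ext (g.symm_apply_apply _)

lemma rotate_rotate_symm (g : E3 ≃ₗᵢ[ℝ] E3) (x : S2) : rotate g (rotate g.symm x) = x :=
  Subtype.ext (g.apply_symm_apply _)

instance : IsFiniteMeasure surfaceMeasure := by unfold surfaceMeasure; infer_instance

instance : surfaceMeasure.IsOpenPosMeasure := by unfold surfaceMeasure; infer_instance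

/-- The surface measure is invariant under linear isometries. -/
theorem measurePreserving_rotate (g : E3 ≃ₗᵢ[ℝ] E3) :
    MeasurePreserving (rotate g) surfaceMeasure surfaceMeasure := by
  refine ⟨(continuous_rotate g).measurable, ?_⟩
  ext s hs
  rw [Measure.map_apply (continuous_rotate g).measurable hs, surfaceMeasure,
    Measure.toSphere_apply' _ hs,
    Measure.toSphere_apply' _ ((continuous_rotate g).measurable hs)]
  congr 1
  have hset : Set.Ioo (0 : ℝ) 1 • ((↑) '' (rotate g ⁻¹' s) : Set E3) =
      g ⁻¹' (Set.Ioo (0 : ℝ) 1 • ((↑) '' s : Set E3)) := by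
    ext v
    simp only [Set.mem_smul, Set.mem_image, Set.mem_preimage]
    constructor
    · rintro ⟨r, hr, _, ⟨x, hx, rfl⟩, rfl⟩
      exact ⟨r, hr, _, ⟨rotate g x, hx, rfl⟩, (map_smul g r (x : E3)).symm⟩
    · rintro ⟨r, hr, _, ⟨x, hx, rfl⟩, hv⟩
      refine ⟨r, hr, _, ⟨rotate g.symm x, by rwa [rotate_rotate_symm], rfl⟩, ?_⟩
      apply g.injective
      rw [map_smul, ← hv]
      change r • g (g.symm x) = _
      rw [g.apply_symm_apply]
  rw [hset]
  exact g.measurePreserving.measure_preimage_emb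
    g.toHomeomorph.measurableEmbedding _

theorem integral_comp_rotate {F : Type*} [NormedAddCommGroup F] [NormedSpace ℝ F]
    (g : E3 ≃ₗᵢ[ℝ] E3) (f : S2 → F) :
    ∫ z, f (rotate g z) ∂surfaceMeasure = ∫ z, f z ∂surfaceMeasure := by
  let e : S2 ≃ₜ S2 :=
    { toFun := rotate g
      invFun := rotate g.symm
      left_inv := rotate_symm_rotate g
      right_inv := rotate_rotate_symm g
      continuous_toFun := continuous_rotate g
      continuous_invFun := continuous_rotate g.symm }
  exact (measurePreserving_rotate g).integral_comp e.measurableEmbedding f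

theorem surfaceMeasure_real_univ : surfaceMeasure.real Set.univ = 4 * Real.pi := by
  rw [surfaceMeasure, Measure.toSphere_real_apply_univ, measureReal_def,
    EuclideanSpace.volume_ball_fin_three]
  simp
  rw [ENNReal.toReal_ofReal (by positivity)]
  ring

/-- Integrals of functions of the inner products with two points only depend on the inner product
of these points. -/
theorem integral_inner_inner_congr {F : Type*} [NormedAddCommGroup F] [NormedSpace ℝ F]
    (f : ℝ → ℝ → F) {x y x' y' : S2}
    (h : inner ℝ (x : E3) (y : E3) = inner ℝ (x' : E3) (y' : E3)) :
    ∫ z : S2, f (inner ℝ (z : E3) (x : E3)) (inner ℝ (z : E3) (y : E3)) ∂surfaceMeasure =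
      ∫ z : S2, f (inner ℝ (z : E3) (x' : E3)) (inner ℝ (z : E3) (y' : E3)) ∂surfaceMeasure := by
  obtain ⟨g, -, rfl, rfl⟩ := exists_rotation_of_inner_eq h
  rw [← integral_comp_rotate g fun z : S2 =>
    f (inner ℝ (z : E3) (rotate g x : E3)) (inner ℝ (z : E3) (rotate g y : E3))]
  simp only [inner_rotate]

theorem integral_inner_congr {F : Type*} [NormedAddCommGroup F] [NormedSpace ℝ F]
    (f : ℝ → F) (x x' : S2) :
    ∫ z : S2, f (inner ℝ (z : E3) (x : E3)) ∂surfaceMeasure =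
      ∫ z : S2, f (inner ℝ (z : E3) (x' : E3)) ∂surfaceMeasure :=
  integral_inner_inner_congr (fun a _ => f a) (y := x) (y' := x')
    (by rw [inner_self_sphere, inner_self_sphere])

/-! ### Legendre polynomials -/

open Polynomial in
theorem degree_legendre_le (l : ℕ) : (legendre l).natDegree ≤ l := by
  have h1 : (((X : ℝ[X]) ^ 2 - 1) ^ l).natDegree ≤ 2 * l := by
    refine natDegree_pow_le.trans ?_
    have : ((X : ℝ[X]) ^ 2 - 1).natDegree ≤ 2 := by compute_degree
    rw [mul_comm]; gcongr
  refine (natDegree_C_mul_le _ _).trans ((natDegree_iterate_derivative _ _).trans ?_)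
  omega

open Polynomial in
/-- The Taylor coefficients of the Legendre polynomials at the points `±1`. -/
theorem eval_iterate_derivative_legendre (l k : ℕ) {a : ℝ} (ha : a ^ 2 = 1) :
    (derivative^[k] (legendre l)).eval a =
      (2 : ℝ)⁻¹ ^ l * ((l.factorial : ℝ))⁻¹ * (k + l).factorial *
        ((X + C (2 * a)) ^ l : ℝ[X]).coeff k := by
  -- At a = ±1, (X + a)² - 1 = X(X + 2a), so the Taylor expansion at a is explicit.
  have h1 : taylor a (((X : ℝ[X]) ^ 2 - 1) ^ l) = X ^ l * (X + C (2 * a)) ^ l := by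
    rw [taylor_apply, pow_comp, sub_comp, pow_comp, X_comp, one_comp, ← mul_pow]
    congr 1
    have hC : (C a : ℝ[X]) ^ 2 = 1 := by rw [← C_pow, ha, C_1]
    rw [C_mul]
    have h2 : (C 2 : ℝ[X]) = 2 := rfl
    rw [h2]
    linear_combination hC
  have h2 : (derivative^[k + l] (((X : ℝ[X]) ^ 2 - 1) ^ l)).eval a =
      (k + l).factorial * ((X + C (2 * a)) ^ l : ℝ[X]).coeff k := by
    rw [← factorial_smul_hasseDeriv, LinearMap.smul_apply, eval_smul, ← taylor_coeff, h1,
      coeff_X_pow_mul, nsmul_eq_mul]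
  rw [legendre, iterate_derivative_C_mul, eval_mul, eval_C, ← Function.iterate_add_apply, h2]
  ring

theorem eval_legendre (l : ℕ) {a : ℝ} (ha : a ^ 2 = 1) : (legendre l).eval a = a ^ l := by
  have := eval_iterate_derivative_legendre l 0 ha
  rw [Function.iterate_zero_apply, Polynomial.coeff_X_add_C_pow] at this
  rw [this, zero_add, Nat.choose_zero_right, Nat.sub_zero, mul_pow, inv_pow]
  have := Nat.factorial_ne_zero l
  field_simp
  simp

theorem eval_one_legendre (l : ℕ) : (legendre l).eval 1 = 1 := by
  rw [eval_legendre l (one_pow 2), one_pow]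

theorem eval_one_derivative_legendre (l : ℕ) :
    (Polynomial.derivative (legendre l)).eval 1 = l * (l + 1) / 2 := by
  have := eval_iterate_derivative_legendre l 1 (one_pow 2)
  rw [Function.iterate_one, Polynomial.coeff_X_add_C_pow] at this
  rw [this, Nat.choose_one_right, mul_one, add_comm 1 l, Nat.factorial_succ]
  have := Nat.factorial_ne_zero l
  rcases l with _ | l
  · simp
  · push_cast
    rw [inv_pow, pow_succ]
    field_simp

lemma intervalIntegrable_eval (p : Polynomial ℝ) (a b : ℝ) :
    IntervalIntegrable (fun t => p.eval t) volume a b := p.continuous.intervalIntegrable a b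

lemma integral_eval_derivative (p : Polynomial ℝ) (a b : ℝ) :
    ∫ t in a..b, (Polynomial.derivative p).eval t = p.eval b - p.eval a :=
  intervalIntegral.integral_eq_sub_of_hasDerivAt (fun x _ => p.hasDerivAt x)
    (intervalIntegrable_eval _ _ _)

open Polynomial in
-- Integration by parts j times. The boundary terms vanish because a derivative of (X² - 1)^l of
-- order below l is still divisible by X² - 1.
lemma integral_iterate_derivative_mul (l : ℕ) : ∀ j ≤ l, ∀ q : ℝ[X],
    ∫ t in (-1 : ℝ)..1, (derivative^[j] (((X : ℝ[X]) ^ 2 - 1) ^ l) * q).eval t =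
      (-1) ^ j * ∫ t in (-1 : ℝ)..1, ((((X : ℝ[X]) ^ 2 - 1) ^ l) * derivative^[j] q).eval t := by
  intro j
  induction j with
  | zero => intro _ q; simp
  | succ j ih =>
    intro hj q
    set w := derivative^[j] (((X : ℝ[X]) ^ 2 - 1) ^ l) with hw
    have h0 : ∀ a : ℝ, a ^ 2 = 1 → w.eval a = 0 := by
      intro a ha
      obtain ⟨r, hr⟩ := pow_sub_dvd_iterate_derivative_pow ((X : ℝ[X]) ^ 2 - 1) l j
      rw [hw, hr, eval_mul, eval_pow]
      simp [ha, show l - j ≠ 0 by omega]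
    have h1 : ∫ t in (-1 : ℝ)..1, (derivative (w * q)).eval t = 0 := by
      rw [integral_eval_derivative, eval_mul, eval_mul, h0 1 (by norm_num), h0 (-1) (by norm_num)]
      ring
    have h2 := ih (by omega) (derivative q)
    rw [Function.iterate_succ_apply', Function.iterate_succ_apply, pow_succ (-1 : ℝ)]
    simp only [derivative_mul, eval_add] at h1
    rw [intervalIntegral.integral_add (intervalIntegrable_eval _ _ _)
      (intervalIntegrable_eval _ _ _), h2] at h1
    linarith

/-- The Legendre polynomials are orthogonal to all polynomials of lower degree. -/
theorem integral_legendre_mul_eq_zero (l : ℕ) {q : Polynomial ℝ} (hq : q.degree < l) :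
    ∫ t in (-1 : ℝ)..1, (legendre l * q).eval t = 0 := by
  have h := integral_iterate_derivative_mul l l le_rfl q
  rw [Polynomial.iterate_derivative_eq_zero_of_degree_lt hq] at h
  simp only [mul_zero, Polynomial.eval_zero, intervalIntegral.integral_zero] at h
  simp only [legendre, mul_assoc]
  simp only [Polynomial.eval_mul (p := Polynomial.C _), Polynomial.eval_C,
    intervalIntegral.integral_const_mul, h, mul_zero]

open Polynomial in
-- Integrate (t p²)' = (2l + 1) p² + 2p(t p' - l p). The factor t p' - l p has degree below l, so
-- its integral against p vanishes, and the boundary values are p(±1)² = 1.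
theorem integral_legendre_sq (l : ℕ) :
    ∫ t in (-1 : ℝ)..1, (legendre l * legendre l).eval t = 2 / (2 * l + 1) := by
  set p := legendre l with hp
  have h1 := integral_eval_derivative (X * (p * p)) (-1) 1
  have h2 : (X * derivative p - C (l : ℝ) * p).degree < (l : WithBot ℕ) := by
    rw [degree_lt_iff_coeff_zero]
    intro m hm
    have hd := degree_legendre_le l
    rw [coeff_sub, coeff_C_mul]
    rcases m with _ | m
    · obtain rfl : l = 0 := by omega
      simp
    · rw [coeff_X_mul, coeff_derivative]
      rcases hm.eq_or_lt with rfl | hm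
      · push_cast; ring
      · rw [coeff_eq_zero_of_natDegree_lt (hd.trans_lt hm)]; simp
  have h3 := integral_legendre_mul_eq_zero l h2
  have e1 : ∀ t : ℝ, (derivative (X * (p * p))).eval t =
      (2 * l + 1) * (p * p).eval t + 2 * (p * (X * derivative p - C (l : ℝ) * p)).eval t := by
    intro t
    simp only [derivative_mul, derivative_X, eval_add, eval_mul, eval_sub, eval_X, eval_C, one_mul]
    ring
  simp only [e1] at h1
  rw [intervalIntegral.integral_add ((intervalIntegrable_eval _ _ _).const_mul _)
    ((intervalIntegrable_eval _ _ _).const_mul _), intervalIntegral.integral_const_mul,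
    intervalIntegral.integral_const_mul, h3] at h1
  have ha : p.eval 1 = 1 := eval_one_legendre l
  have hb : p.eval (-1) = (-1) ^ l := eval_legendre l (by norm_num)
  have hb2 : ((-1 : ℝ) ^ l) * (-1) ^ l = 1 := by rw [← mul_pow]; norm_num
  simp only [eval_mul, eval_X, ha, hb, hb2] at h1
  simp only [eval_mul]
  rw [eq_div_iff (by positivity)]
  linarith

/-- Otherwise the polynomial would have degree below l and be orthogonal to itself. -/
theorem coeff_legendre_ne_zero (l : ℕ) : (legendre l).coeff l ≠ 0 := by
  intro h0
  have hd : (legendre l).degree < l := by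
    rw [Polynomial.degree_lt_iff_coeff_zero]
    intro m hm
    rcases hm.eq_or_lt with rfl | hm
    · exact h0
    · exact Polynomial.coeff_eq_zero_of_natDegree_lt ((degree_legendre_le l).trans_lt hm)
  have := integral_legendre_mul_eq_zero l hd
  rw [integral_legendre_sq] at this
  exact absurd this (by positivity)

/-! ### Integrals of zonal polynomials -/

lemma integrable_of_continuous {f : S2 → ℝ} (hf : Continuous f) : Integrable f surfaceMeasure :=
  hf.integrable_of_hasCompactSupport (HasCompactSupport.of_compactSpace f)

lemma continuous_inner_sphere (v : E3) : Continuous fun z : S2 => inner ℝ (z : E3) v := by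
  fun_prop

/-- The moments of the coordinates of a point of the sphere along two orthogonal unit vectors. -/
theorem succ_mul_integral_inner_pow_mul_sq (b : OrthonormalBasis (Fin 3) ℝ E3) (x : S2)
    (hx : b 0 = x) (i : Fin 3) (hi : i ≠ 0) (m : ℕ) :
    (2 * m + 1) * ∫ z : S2, inner ℝ (z : E3) (x : E3) ^ (2 * m) * inner ℝ (z : E3) (b i) ^ 2
      ∂surfaceMeasure = ∫ z : S2, inner ℝ (z : E3) (x : E3) ^ (2 * (m + 1)) ∂surfaceMeasure := by
  set I : ℕ → ℝ := fun j => ∫ z : S2,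
    inner ℝ (z : E3) (b i) ^ j * inner ℝ (z : E3) (x : E3) ^ (2 * (m + 1) - j) ∂surfaceMeasure
    with hI
  set M := ∫ z : S2, inner ℝ (z : E3) (x : E3) ^ (2 * (m + 1)) ∂surfaceMeasure with hM
  -- By rotation invariance, the integral of ⟨z, x + β b i⟩^(2(m+1)) is M ‖x + β b i‖^(2(m+1)) = M
  -- (1 + β²)^(m+1). Both sides are polynomials in β, and the coefficient of β² gives the claim.
  have hpoly : (∑ j ∈ Finset.range (2 * (m + 1) + 1),
      Polynomial.C (I j * (2 * (m + 1)).choose j) * Polynomial.X ^ j : Polynomial ℝ) =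
      Polynomial.C M * Polynomial.expand ℝ 2 ((1 + Polynomial.X) ^ (m + 1)) := by
    refine Polynomial.funext fun β => ?_
    have hn : ‖(x : E3) + β • b i‖ ^ 2 = 1 + β ^ 2 := by
      rw [norm_add_sq_real, ← hx, inner_smul_right, b.orthonormal.2 hi.symm, norm_smul,
        b.norm_eq_one, b.norm_eq_one, Real.norm_eq_abs, mul_one, sq_abs]
      ring
    set c := ‖(x : E3) + β • b i‖ with hc
    have hc0 : c ≠ 0 := by
      intro h
      rw [h] at hn
      nlinarith [sq_nonneg β]
    let y : S2 := ⟨c⁻¹ • ((x : E3) + β • b i), by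
      rw [mem_sphere_zero_iff_norm, norm_smul, norm_inv, ← hc, hc, norm_norm, ← hc,
        inv_mul_cancel₀ hc0]⟩
    have hy : ∀ z : S2, β * inner ℝ (z : E3) (b i) + inner ℝ (z : E3) (x : E3) =
        c * inner ℝ (z : E3) (y : E3) := by
      intro z
      rw [← inner_smul_right, ← inner_add_right, ← inner_smul_right]
      change _ = inner ℝ (z : E3) (c • c⁻¹ • ((x : E3) + β • b i))
      rw [smul_smul, mul_inv_cancel₀ hc0, one_smul, add_comm]
    have h1 : ∫ z : S2, (β * inner ℝ (z : E3) (b i) + inner ℝ (z : E3) (x : E3)) ^ (2 * (m + 1))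
        ∂surfaceMeasure = (1 + β ^ 2) ^ (m + 1) * M := by
      simp only [hy, mul_pow]
      rw [integral_const_mul, pow_mul, hn, hM,
        integral_inner_congr (fun s => s ^ (2 * (m + 1))) y x]
    rw [Polynomial.eval_finsetSum]
    simp only [Polynomial.eval_mul, Polynomial.eval_C, Polynomial.eval_pow, Polynomial.eval_X,
      Polynomial.expand_eval, Polynomial.eval_add, Polynomial.eval_one]
    rw [mul_comm M, ← h1]
    simp only [add_pow]
    rw [integral_finsetSum _ fun j _ => integrable_of_continuous (by fun_prop)]
    refine Finset.sum_congr rfl fun j _ => ?_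
    rw [integral_mul_const, hI]
    simp only [mul_pow, mul_assoc]
    rw [integral_const_mul]
    ring
  have h2 := congrArg (fun p => p.coeff 2) hpoly
  simp only [Polynomial.finsetSum_coeff, Polynomial.coeff_C_mul, Polynomial.coeff_X_pow] at h2
  rw [Finset.sum_eq_single 2 (fun j _ hj => by simp [hj.symm])
    (fun h => absurd (Finset.mem_range.2 (by omega)) h)] at h2
  have h3 := Polynomial.coeff_expand_mul (R := ℝ) (p := 2) two_pos
    ((1 + Polynomial.X) ^ (m + 1)) 1
  rw [one_mul] at h3
  rw [h3, Polynomial.coeff_one_add_X_pow, Nat.choose_one_right, if_pos rfl, mul_one,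
    Nat.cast_choose_two] at h2
  have h4 : I 2 = ∫ z : S2, inner ℝ (z : E3) (x : E3) ^ (2 * m) * inner ℝ (z : E3) (b i) ^ 2
      ∂surfaceMeasure := by
    have e : 2 * (m + 1) - 2 = 2 * m := by omega
    simp only [hI, e]
    exact integral_congr_ae (.of_forall fun z => mul_comm _ _)
  rw [← h4]
  push_cast at h2
  have h5 : ((m : ℝ) + 1) ≠ 0 := by positivity
  apply mul_left_cancel₀ h5
  linarith

/-- Multiplying by 1 = ⟨z, b 0⟩² + ⟨z, b 1⟩² + ⟨z, b 2⟩² expresses a moment through the next one,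
since the mixed moments are multiples of that one. -/
theorem integral_inner_pow_even (x : S2) (m : ℕ) :
    ∫ z : S2, inner ℝ (z : E3) (x : E3) ^ (2 * m) ∂surfaceMeasure = 4 * Real.pi / (2 * m + 1) := by
  induction m with
  | zero => simp [surfaceMeasure_real_univ]
  | succ m ih =>
    obtain ⟨b, hb, -⟩ := exists_adapted_frame x x
    have h1 := succ_mul_integral_inner_pow_mul_sq b x hb 1 (by decide) m
    have h2 := succ_mul_integral_inner_pow_mul_sq b x hb 2 (by decide) m
    have h3 : ∀ z : S2, inner ℝ (z : E3) (x : E3) ^ (2 * m) =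
        inner ℝ (z : E3) (x : E3) ^ (2 * (m + 1)) +
        inner ℝ (z : E3) (x : E3) ^ (2 * m) * inner ℝ (z : E3) (b 1) ^ 2 +
        inner ℝ (z : E3) (x : E3) ^ (2 * m) * inner ℝ (z : E3) (b 2) ^ 2 := by
      intro z
      have := b.sum_sq_norm_inner_left (z : E3)
      rw [Fin.sum_univ_three, hb, norm_eq_of_mem_sphere] at this
      simp only [Real.norm_eq_abs, sq_abs] at this
      rw [mul_add, pow_add, mul_one]
      linear_combination -(inner ℝ (z : E3) (x : E3) ^ (2 * m)) * this
    rw [integral_congr_ae (.of_forall h3), integral_add, integral_add] at ih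
    · have h5 : (2 * (m : ℝ) + 1) ≠ 0 := by positivity
      have h6 : (2 * ((m : ℝ) + 1) + 1) ≠ 0 := by positivity
      rw [eq_div_of_mul_eq h5 ((mul_comm _ _).trans h1),
        eq_div_of_mul_eq h5 ((mul_comm _ _).trans h2)] at ih
      push_cast
      field_simp at ih ⊢
      linarith
    all_goals exact integrable_of_continuous (by fun_prop)

theorem integral_inner_pow_odd (x : S2) (m : ℕ) :
    ∫ z : S2, inner ℝ (z : E3) (x : E3) ^ (2 * m + 1) ∂surfaceMeasure = 0 := by
  have h := integral_comp_rotate (LinearIsometryEquiv.neg ℝ)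
    fun z : S2 => inner ℝ (z : E3) (x : E3) ^ (2 * m + 1)
  simp only [rotate, LinearIsometryEquiv.coe_neg, inner_neg_left, Odd.neg_pow ⟨m, rfl⟩,
    integral_neg] at h
  linarith

/-- Archimedes' hat-box theorem for polynomials. -/
theorem integral_eval_inner (p : Polynomial ℝ) (x : S2) :
    ∫ z : S2, p.eval (inner ℝ (z : E3) (x : E3)) ∂surfaceMeasure =
      2 * Real.pi * ∫ t in (-1 : ℝ)..1, p.eval t := by
  induction p using Polynomial.induction_on' with
  | add p q hp hq =>
    simp only [Polynomial.eval_add]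
    rw [integral_add (integrable_of_continuous (by fun_prop))
      (integrable_of_continuous (by fun_prop)), hp, hq,
      intervalIntegral.integral_add (intervalIntegrable_eval _ _ _)
      (intervalIntegrable_eval _ _ _)]
    ring
  | monomial n a =>
    simp only [Polynomial.eval_monomial]
    rw [integral_const_mul, intervalIntegral.integral_const_mul, integral_pow]
    rcases Nat.even_or_odd' n with ⟨m, rfl | rfl⟩
    · rw [integral_inner_pow_even, Odd.neg_pow ⟨m, rfl⟩]
      push_cast
      ring
    · rw [integral_inner_pow_odd, Even.neg_pow ⟨m + 1, by ring⟩]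
      ring

/-! ### Zonal convolution -/

/-- Measurable zonal kernels that are bounded on `[-1, 1]`. -/
structure IsBoundedKernel (k : ℝ → ℝ) : Prop where
  measurable : Measurable k
  bounded : ∃ B, ∀ t ∈ Set.Icc (-1 : ℝ) 1, |k t| ≤ B

lemma isBoundedKernel_eval (p : Polynomial ℝ) : IsBoundedKernel fun t => p.eval t := by
  refine ⟨p.continuous.measurable, ?_⟩
  obtain ⟨B, hB⟩ := (isCompact_Icc (a := (-1 : ℝ)) (b := 1)).exists_bound_of_continuousOn
    p.continuous.continuousOn
  exact ⟨B, hB⟩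

lemma IsBoundedKernel.integrable_mul {k : ℝ → ℝ} (hk : IsBoundedKernel k) (y : S2) {f : S2 → ℝ}
    (hf : Continuous f) :
    Integrable (fun z : S2 => k (inner ℝ (z : E3) (y : E3)) * f z) surfaceMeasure := by
  obtain ⟨B, hB⟩ := hk.bounded
  exact (integrable_of_continuous hf).bdd_mul (c := B)
    (hk.measurable.comp (continuous_inner_sphere y).measurable).aestronglyMeasurable
    (.of_forall fun z => hB _ (inner_mem_Icc z y))

lemma IsBoundedKernel.integrable_prod_mul {k : ℝ → ℝ} (hk : IsBoundedKernel k) (y : S2)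
    {f : S2 × S2 → ℝ} (hf : Continuous f) :
    Integrable (fun w : S2 × S2 => k (inner ℝ (w.2 : E3) (y : E3)) * f w)
      (surfaceMeasure.prod surfaceMeasure) := by
  obtain ⟨B, hB⟩ := hk.bounded
  refine Integrable.bdd_mul (c := B) (hf.integrable_of_hasCompactSupport
    (HasCompactSupport.of_compactSpace f)) ?_ (.of_forall fun w => hB _ (inner_mem_Icc w.2 y))
  exact (hk.measurable.comp
    ((continuous_inner_sphere y).measurable.comp measurable_snd)).aestronglyMeasurable

open Polynomial in
/-- The zonal convolution of a bounded kernel with a polynomial is a polynomial of no larger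
degree. -/
theorem exists_zonal_convolution {k : ℝ → ℝ} (hk : IsBoundedKernel k) (n : ℕ) (q : ℝ[X])
    (hq : q.natDegree ≤ n) : ∃ G : ℝ[X], G.natDegree ≤ n ∧ ∀ x y : S2,
      ∫ z : S2, k (inner ℝ (z : E3) (y : E3)) * q.eval (inner ℝ (z : E3) (x : E3)) ∂surfaceMeasure =
        G.eval (inner ℝ (x : E3) (y : E3)) := by
  refine induction_with_natDegree_le (fun q => ∃ G : ℝ[X], G.natDegree ≤ n ∧ ∀ x y : S2,
      ∫ z : S2, k (inner ℝ (z : E3) (y : E3)) * q.eval (inner ℝ (z : E3) (x : E3)) ∂surfaceMeasure =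
        G.eval (inner ℝ (x : E3) (y : E3))) n ⟨0, by simp⟩ ?_ ?_ q hq
  · intro m r _ hm
    let b := EuclideanSpace.basisFun (Fin 3) ℝ
    let y₀ : S2 := ⟨b 0, by simp [b]⟩
    let u₀ : S2 := ⟨b 1, by simp [b]⟩
    have hyu : inner ℝ (y₀ : E3) (u₀ : E3) = 0 := b.orthonormal.2 (by decide)
    set c : ℕ → ℝ := fun j => ∫ z : S2, k (inner ℝ (z : E3) (y₀ : E3)) *
      (inner ℝ (z : E3) (u₀ : E3) ^ j * inner ℝ (z : E3) (y₀ : E3) ^ (m - j)) ∂surfaceMeasure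
      with hc
    -- Some isometry fixes y₀ and exchanges u₀ with -u₀. In x = t y + s u, s = √(1 - t²), only even
    -- powers of s therefore survive, and the result is a polynomial in t.
    have hodd : ∀ j, Odd j → c j = 0 := by
      intro j hj
      have := integral_inner_inner_congr (fun s t => k s * (t ^ j * s ^ (m - j)))
        (x := y₀) (y := -u₀) (x' := y₀) (y' := u₀)
        (by rw [coe_neg_sphere, inner_neg_right, hyu, neg_zero])
      simp only [coe_neg_sphere, inner_neg_right, hj.neg_pow, neg_mul, mul_neg,
        integral_neg] at this
      simp only [hc]
      linarith
    refine ⟨∑ j ∈ Finset.range (m + 1), C (r * c j * m.choose j) *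
      (X ^ (m - j) * (1 - X ^ 2) ^ (j / 2)), ?_, fun x y => ?_⟩
    · refine natDegree_sum_le_of_forall_le _ _ fun j hj => ?_
      have hj' := Finset.mem_range.1 hj
      refine (natDegree_C_mul_le _ _).trans (natDegree_mul_le.trans ?_)
      have h1 : ((1 - X ^ 2 : ℝ[X]) ^ (j / 2)).natDegree ≤ j / 2 * 2 := by
        refine natDegree_pow_le_of_le _ ?_
        compute_degree
      rw [natDegree_X_pow]
      omega
    · obtain ⟨d, hd0, hd1⟩ := exists_adapted_frame y x
      rw [real_inner_comm] at hd1
      set t := inner ℝ (x : E3) (y : E3) with ht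
      have ht1 : 0 ≤ 1 - t ^ 2 := by
        have := inner_mem_Icc x y
        rw [← ht] at this
        nlinarith [this.1, this.2]
      set s := Real.sqrt (1 - t ^ 2) with hs
      let u : S2 := ⟨d 1, by simp⟩
      have hyu' : inner ℝ (y : E3) (u : E3) = 0 := by
        rw [← hd0]; exact d.orthonormal.2 (by decide)
      have hzx : ∀ z : S2, inner ℝ (z : E3) (x : E3) =
          s * inner ℝ (z : E3) (u : E3) + t * inner ℝ (z : E3) (y : E3) := by
        intro z
        rw [hd1, inner_add_right, inner_smul_right, inner_smul_right, add_comm]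
      have hcj : ∀ j, ∫ z : S2, k (inner ℝ (z : E3) (y : E3)) *
          (inner ℝ (z : E3) (u : E3) ^ j * inner ℝ (z : E3) (y : E3) ^ (m - j)) ∂surfaceMeasure =
          c j := fun j =>
        integral_inner_inner_congr (fun s t => k s * (t ^ j * s ^ (m - j)))
          (hyu'.trans hyu.symm)
      have hexp : ∀ z : S2, k (inner ℝ (z : E3) (y : E3)) *
          (C r * X ^ m : ℝ[X]).eval (inner ℝ (z : E3) (x : E3)) =
          ∑ j ∈ Finset.range (m + 1), r * m.choose j * s ^ j * t ^ (m - j) *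
            (k (inner ℝ (z : E3) (y : E3)) *
            (inner ℝ (z : E3) (u : E3) ^ j * inner ℝ (z : E3) (y : E3) ^ (m - j))) := by
        intro z
        rw [eval_mul, eval_C, eval_pow, eval_X, hzx, add_pow, Finset.mul_sum, Finset.mul_sum]
        refine Finset.sum_congr rfl fun j _ => ?_
        rw [mul_pow, mul_pow]
        ring
      rw [integral_congr_ae (.of_forall hexp), integral_finsetSum _ fun j _ =>
        (hk.integrable_mul y (by fun_prop)).const_mul _, eval_finsetSum]
      refine Finset.sum_congr rfl fun j _ => ?_
      rw [integral_const_mul, hcj]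
      simp only [eval_mul, eval_C, eval_pow, eval_X, eval_sub, eval_one]
      rcases Nat.even_or_odd' j with ⟨i, rfl | rfl⟩
      · rw [Nat.mul_div_cancel_left i two_pos, pow_mul s, hs, Real.sq_sqrt ht1]
        ring
      · rw [hodd _ ⟨i, rfl⟩]
        ring
  · rintro f g - - ⟨F, hF, hF'⟩ ⟨G, hG, hG'⟩
    refine ⟨F + G, natDegree_add_le_of_degree_le hF hG, fun x y => ?_⟩
    simp only [eval_add, mul_add]
    rw [integral_add (hk.integrable_mul y (by fun_prop)) (hk.integrable_mul y (by fun_prop)), hF',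
      hG']

/-- Zonal convolution is symmetric for the inner product of zonal functions. -/
theorem integral_zonal_convolution_mul {f : ℝ → ℝ} (hf : IsBoundedKernel f)
    {g h F H : Polynomial ℝ}
    (hF : ∀ x y : S2, ∫ z : S2, f (inner ℝ (z : E3) (y : E3)) *
      g.eval (inner ℝ (z : E3) (x : E3)) ∂surfaceMeasure = F.eval (inner ℝ (x : E3) (y : E3)))
    (hH : ∀ x y : S2, ∫ z : S2, g.eval (inner ℝ (z : E3) (y : E3)) *
      h.eval (inner ℝ (z : E3) (x : E3)) ∂surfaceMeasure = H.eval (inner ℝ (x : E3) (y : E3)))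
    (e : S2) :
    ∫ x : S2, F.eval (inner ℝ (x : E3) (e : E3)) * h.eval (inner ℝ (x : E3) (e : E3))
      ∂surfaceMeasure =
    ∫ z : S2, f (inner ℝ (z : E3) (e : E3)) * H.eval (inner ℝ (z : E3) (e : E3))
      ∂surfaceMeasure := by
  have h1 : ∀ x : S2, F.eval (inner ℝ (x : E3) (e : E3)) * h.eval (inner ℝ (x : E3) (e : E3)) =
      ∫ z : S2, f (inner ℝ (z : E3) (e : E3)) * (g.eval (inner ℝ (z : E3) (x : E3)) *
        h.eval (inner ℝ (x : E3) (e : E3))) ∂surfaceMeasure := by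
    intro x
    rw [← hF, ← integral_mul_const]
    simp only [mul_assoc]
  have h2 : ∀ z : S2, f (inner ℝ (z : E3) (e : E3)) * H.eval (inner ℝ (z : E3) (e : E3)) =
      ∫ x : S2, f (inner ℝ (z : E3) (e : E3)) * (g.eval (inner ℝ (z : E3) (x : E3)) *
        h.eval (inner ℝ (x : E3) (e : E3))) ∂surfaceMeasure := by
    intro z
    rw [integral_const_mul, real_inner_comm (e : E3) (z : E3), ← hH, real_inner_comm]
    simp only [real_inner_comm (z : E3)]
  rw [integral_congr_ae (.of_forall h1), integral_congr_ae (.of_forall h2)]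
  exact integral_integral_swap (hf.integrable_prod_mul e
    (f := fun w => g.eval (inner ℝ (w.2 : E3) (w.1 : E3)) * h.eval (inner ℝ (w.1 : E3) (e : E3)))
    (by fun_prop))

lemma eval_inner_eq_zero_of_integral_sq {p : Polynomial ℝ} {e : S2}
    (h : ∫ z : S2, p.eval (inner ℝ (z : E3) (e : E3)) * p.eval (inner ℝ (z : E3) (e : E3))
      ∂surfaceMeasure = 0) (x y : S2) : p.eval (inner ℝ (x : E3) (y : E3)) = 0 := by
  have h0 : ∫ z : S2, p.eval (inner ℝ (z : E3) (y : E3)) * p.eval (inner ℝ (z : E3) (y : E3))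
      ∂surfaceMeasure = 0 := (integral_inner_congr (fun t => p.eval t * p.eval t) y e).trans h
  have hc : Continuous fun z : S2 =>
      p.eval (inner ℝ (z : E3) (y : E3)) * p.eval (inner ℝ (z : E3) (y : E3)) := by fun_prop
  rw [integral_eq_zero_iff_of_nonneg (fun z => mul_self_nonneg _) (integrable_of_continuous hc)]
    at h0
  exact mul_self_eq_zero.1
    (congrFun ((hc.ae_eq_iff_eq surfaceMeasure continuous_zero).1 h0) x)

lemma integral_legendre_inner_mul_eq_zero (l : ℕ) {q : Polynomial ℝ} (hq : q.degree < l) (e : S2) :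
    ∫ z : S2, (legendre l).eval (inner ℝ (z : E3) (e : E3)) * q.eval (inner ℝ (z : E3) (e : E3))
      ∂surfaceMeasure = 0 := by
  simp only [← Polynomial.eval_mul]
  rw [integral_eval_inner, integral_legendre_mul_eq_zero l hq, mul_zero]

theorem integral_legendre_inner_sq (l : ℕ) (e : S2) :
    ∫ z : S2, (legendre l).eval (inner ℝ (z : E3) (e : E3)) *
      (legendre l).eval (inner ℝ (z : E3) (e : E3)) ∂surfaceMeasure =
      4 * Real.pi / (2 * l + 1) := by
  simp only [← Polynomial.eval_mul]
  rw [integral_eval_inner, integral_legendre_sq]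
  ring

/-- The convolution H of P_l and q satisfies ∫ H² = ∫ P_l · (q * H) by symmetry, and q * H has
degree below l. So orthogonality at a common pole already forces H = 0 for two different poles. -/
theorem integral_legendre_mul_lower_degree (l : ℕ) {q : Polynomial ℝ} (hq : q.degree < l)
    (x y : S2) : ∫ z : S2, (legendre l).eval (inner ℝ (z : E3) (y : E3)) *
      q.eval (inner ℝ (z : E3) (x : E3)) ∂surfaceMeasure = 0 := by
  rcases eq_or_ne q 0 with rfl | hq0
  · simp
  have hn : q.natDegree < l := (Polynomial.natDegree_lt_iff_degree_lt hq0).2 hq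
  obtain ⟨H, hHd, hH⟩ := exists_zonal_convolution (isBoundedKernel_eval (legendre l)) _ q le_rfl
  obtain ⟨H', hHd', hH'⟩ := exists_zonal_convolution (isBoundedKernel_eval q) _ H hHd
  rw [hH]
  refine eval_inner_eq_zero_of_integral_sq (e := x) ?_ x y
  rw [integral_zonal_convolution_mul (isBoundedKernel_eval (legendre l)) hH hH']
  refine integral_legendre_inner_mul_eq_zero l ?_ x
  exact (Polynomial.degree_le_of_natDegree_le hHd').trans_lt (by exact_mod_cast hn)

/-- The **Funk–Hecke formula**. -/
theorem funk_hecke {k : ℝ → ℝ} (hk : IsBoundedKernel k) (l : ℕ) (e x y : S2) :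
    ∫ z : S2, k (inner ℝ (z : E3) (y : E3)) * (legendre l).eval (inner ℝ (z : E3) (x : E3))
      ∂surfaceMeasure =
    (∫ z : S2, k (inner ℝ (z : E3) (e : E3)) * (legendre l).eval (inner ℝ (z : E3) (e : E3))
      ∂surfaceMeasure) * (legendre l).eval (inner ℝ (x : E3) (y : E3)) := by
  obtain ⟨G, hGd, hG⟩ := exists_zonal_convolution hk l (legendre l) (degree_legendre_le l)
  have hlead := coeff_legendre_ne_zero l
  -- The constant cancels the leading term, so R has degree below l. R is orthogonal to P_l, and to
  -- G by symmetry of the convolution; hence ∫ R² = 0. Evaluation at coinciding poles identifies c.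
  set c := G.coeff l / (legendre l).coeff l with hc
  set R := G - Polynomial.C c * legendre l with hR
  have hRd : R.degree < (l : WithBot ℕ) := by
    rw [Polynomial.degree_lt_iff_coeff_zero]
    intro m hm
    rw [hR, Polynomial.coeff_sub, Polynomial.coeff_C_mul]
    rcases hm.eq_or_lt with rfl | hm
    · rw [hc]; field_simp; ring
    · rw [Polynomial.coeff_eq_zero_of_natDegree_lt (hGd.trans_lt hm),
        Polynomial.coeff_eq_zero_of_natDegree_lt ((degree_legendre_le l).trans_lt hm)]
      ring
  have h1 := integral_zonal_convolution_mul hk (h := R) (H := 0) hG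
    (fun x y => by rw [integral_legendre_mul_lower_degree l hRd]; simp) e
  simp only [Polynomial.eval_zero, mul_zero, integral_zero] at h1
  have h2 := integral_legendre_inner_mul_eq_zero l hRd e
  have h3 : ∫ z : S2, R.eval (inner ℝ (z : E3) (e : E3)) * R.eval (inner ℝ (z : E3) (e : E3))
      ∂surfaceMeasure = 0 := by
    have : ∀ z : S2, R.eval (inner ℝ (z : E3) (e : E3)) * R.eval (inner ℝ (z : E3) (e : E3)) =
        G.eval (inner ℝ (z : E3) (e : E3)) * R.eval (inner ℝ (z : E3) (e : E3)) -
        c * ((legendre l).eval (inner ℝ (z : E3) (e : E3)) *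
          R.eval (inner ℝ (z : E3) (e : E3))) := by
      intro z
      nth_rewrite 1 [hR]
      rw [Polynomial.eval_sub, Polynomial.eval_mul, Polynomial.eval_C]
      ring
    rw [integral_congr_ae (.of_forall this), integral_sub (integrable_of_continuous (by fun_prop))
      (integrable_of_continuous (by fun_prop)), integral_const_mul, h1, h2]
    ring
  have h4 : ∀ x y : S2, G.eval (inner ℝ (x : E3) (y : E3)) =
      c * (legendre l).eval (inner ℝ (x : E3) (y : E3)) := by
    intro x y
    have := eval_inner_eq_zero_of_integral_sq h3 x y
    rw [hR, Polynomial.eval_sub, Polynomial.eval_mul, Polynomial.eval_C] at this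
    linarith
  rw [hG, h4, hG, h4, inner_self_sphere, eval_one_legendre, mul_one]

/-! ### Bounds on Legendre polynomials from the reproducing property -/

/-- The reproducing property of the Legendre polynomials. -/
theorem integral_legendre_mul_legendre (l : ℕ) (x y : S2) :
    ∫ z : S2, (legendre l).eval (inner ℝ (z : E3) (y : E3)) *
      (legendre l).eval (inner ℝ (z : E3) (x : E3)) ∂surfaceMeasure =
    4 * Real.pi / (2 * l + 1) * (legendre l).eval (inner ℝ (x : E3) (y : E3)) := by
  rw [funk_hecke (isBoundedKernel_eval (legendre l)) l x, integral_legendre_inner_sq]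

theorem integral_legendre_sub_legendre_sq (l : ℕ) (x y : S2) :
    ∫ z : S2, ((legendre l).eval (inner ℝ (z : E3) (x : E3)) -
      (legendre l).eval (inner ℝ (z : E3) (y : E3))) ^ 2 ∂surfaceMeasure =
    8 * Real.pi / (2 * l + 1) * (1 - (legendre l).eval (inner ℝ (x : E3) (y : E3))) := by
  have : ∀ z : S2, ((legendre l).eval (inner ℝ (z : E3) (x : E3)) -
      (legendre l).eval (inner ℝ (z : E3) (y : E3))) ^ 2 =
      (legendre l).eval (inner ℝ (z : E3) (x : E3)) * (legendre l).eval (inner ℝ (z : E3) (x : E3)) +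
      (legendre l).eval (inner ℝ (z : E3) (y : E3)) * (legendre l).eval (inner ℝ (z : E3) (y : E3)) -
      2 * ((legendre l).eval (inner ℝ (z : E3) (y : E3)) *
        (legendre l).eval (inner ℝ (z : E3) (x : E3))) := fun z => by ring
  rw [integral_congr_ae (.of_forall this), integral_sub (integrable_of_continuous (by fun_prop))
    (integrable_of_continuous (by fun_prop)), integral_add (integrable_of_continuous (by fun_prop))
    (integrable_of_continuous (by fun_prop)), integral_const_mul, integral_legendre_inner_sq,
    integral_legendre_inner_sq, integral_legendre_mul_legendre]
  ring

theorem abs_legendre_inner_le_one (l : ℕ) (x y : S2) :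
    |(legendre l).eval (inner ℝ (x : E3) (y : E3))| ≤ 1 := by
  have hpos : 0 < 8 * Real.pi / (2 * (l : ℝ) + 1) := by positivity
  have h1 : 0 ≤ 1 - (legendre l).eval (inner ℝ (x : E3) (y : E3)) := by
    have h : 0 ≤ ∫ z : S2, ((legendre l).eval (inner ℝ (z : E3) (x : E3)) -
        (legendre l).eval (inner ℝ (z : E3) (y : E3))) ^ 2 ∂surfaceMeasure :=
      integral_nonneg fun z => sq_nonneg _
    rw [integral_legendre_sub_legendre_sq] at h
    exact nonneg_of_mul_nonneg_right h hpos
  -- The integrand is (a + b)² written as (a - b)² + 4ab, so that the previous formulas apply.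
  have h2 : 0 ≤ 1 + (legendre l).eval (inner ℝ (x : E3) (y : E3)) := by
    have h : 0 ≤ ∫ z : S2, ((legendre l).eval (inner ℝ (z : E3) (x : E3)) -
      (legendre l).eval (inner ℝ (z : E3) (y : E3))) ^ 2 +
      4 * ((legendre l).eval (inner ℝ (z : E3) (y : E3)) *
        (legendre l).eval (inner ℝ (z : E3) (x : E3))) ∂surfaceMeasure := by
      refine integral_nonneg fun z => ?_
      have := sq_nonneg ((legendre l).eval (inner ℝ (z : E3) (x : E3)) +
        (legendre l).eval (inner ℝ (z : E3) (y : E3)))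
      simp only [Pi.zero_apply]
      linarith
    rw [integral_add (integrable_of_continuous (by fun_prop))
      (integrable_of_continuous (by fun_prop)), integral_const_mul,
      integral_legendre_sub_legendre_sq, integral_legendre_mul_legendre] at h
    refine nonneg_of_mul_nonneg_right (a := 8 * Real.pi / (2 * (l : ℝ) + 1)) ?_ hpos
    linarith [show 4 * (4 * Real.pi / (2 * (l : ℝ) + 1) *
      (legendre l).eval (inner ℝ (x : E3) (y : E3))) = 2 * (8 * Real.pi / (2 * (l : ℝ) + 1) *
      (legendre l).eval (inner ℝ (x : E3) (y : E3))) by ring]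
  rw [abs_le]
  constructor <;> linarith

/-- A point of the great circle spanned by the first two coordinate vectors. -/
def circlePoint (s : ℝ) : S2 := ⟨!₂[Real.cos s, Real.sin s, 0], by
  simp [EuclideanSpace.norm_eq, Fin.sum_univ_three]⟩

lemma inner_circlePoint (s t : ℝ) :
    inner ℝ (circlePoint s : E3) (circlePoint t : E3) = Real.cos (s - t) := by
  simp [circlePoint, PiLp.inner_apply, Fin.sum_univ_three, Real.cos_sub]
  ring

/-- Up to a common factor, 1 - P_l(cos θ) is the squared L² distance between zonal functions with
poles at angle θ. Splitting the arc into n equal steps and using Cauchy–Schwarz for the sum of n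
increments costs a factor n · n. -/
lemma one_sub_legendre_cos_mul_le (l n : ℕ) (α : ℝ) :
    1 - (legendre l).eval (Real.cos (n * α)) ≤
      (n : ℝ) ^ 2 * (1 - (legendre l).eval (Real.cos α)) := by
  let φ : ℕ → S2 → ℝ := fun i z => (legendre l).eval (inner ℝ (z : E3) (circlePoint (i * α) : E3))
  have hφ : ∀ i, Continuous (φ i) := fun i => by
    simp only [φ]; fun_prop
  have h1 : ∫ z, (φ n z - φ 0 z) ^ 2 ∂surfaceMeasure ≤
      ∫ z, n * ∑ i ∈ Finset.range n, (φ (i + 1) z - φ i z) ^ 2 ∂surfaceMeasure := by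
    refine integral_mono (integrable_of_continuous (((hφ n).sub (hφ 0)).pow 2))
      (integrable_of_continuous (continuous_const.mul (continuous_finsetSum _ fun i _ =>
        ((hφ _).sub (hφ _)).pow 2))) fun z => ?_
    have := sq_sum_le_card_mul_sum_sq (s := Finset.range n) (f := fun i => φ (i + 1) z - φ i z)
    rwa [Finset.sum_range_sub (fun i => φ i z), Finset.card_range] at this
  have hint : ∀ i, Integrable (fun z => (φ (i + 1) z - φ i z) ^ 2) surfaceMeasure := fun i =>
    integrable_of_continuous (((hφ _).sub (hφ _)).pow 2)
  rw [integral_const_mul, integral_finsetSum _ fun i _ => hint i] at h1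
  simp only [φ, integral_legendre_sub_legendre_sq, inner_circlePoint] at h1
  have e : ∀ i : ℕ, ((i + 1 : ℕ) : ℝ) * α - i * α = α := fun i => by push_cast; ring
  simp only [e, Finset.sum_const, Finset.card_range, nsmul_eq_mul, Nat.cast_zero, zero_mul,
    sub_zero] at h1
  have hpos : 0 < 8 * Real.pi / (2 * (l : ℝ) + 1) := by positivity
  refine le_of_mul_le_mul_left (h1.trans_eq ?_) hpos
  ring

open Polynomial in
-- The estimate for n steps of size θ/n, as n → ∞, reduces the bound to the first order behaviour at
-- 1: n²(1 - P_l(cos(θ/n))) is asymptotically at most P_l'(1) θ²/2, with P_l'(1) = l(l+1)/2.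
theorem one_sub_legendre_cos_le (l : ℕ) (θ : ℝ) :
    1 - (legendre l).eval (Real.cos θ) ≤ l * (l + 1) / 4 * θ ^ 2 := by
  obtain ⟨Q, hQ⟩ : (X - C 1 : ℝ[X]) ∣ legendre l - 1 := by
    rw [dvd_iff_isRoot, IsRoot, eval_sub, eval_one_legendre, eval_one, sub_self]
  have hQ1 : Q.eval 1 = l * (l + 1) / 2 := by
    rw [← eval_one_derivative_legendre]
    have := congrArg (fun p => (derivative p).eval 1) hQ
    simpa using this.symm
  have hlim : Tendsto (fun n : ℕ => θ ^ 2 / 2 * |Q.eval (Real.cos (θ / n))|) atTop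
      (𝓝 (θ ^ 2 / 2 * |Q.eval (Real.cos 0)|)) := by
    have hc : Continuous fun s : ℝ => θ ^ 2 / 2 * |Q.eval (Real.cos s)| := by fun_prop
    exact (hc.tendsto 0).comp (tendsto_const_div_atTop_nhds_zero_nat θ)
  rw [Real.cos_zero, hQ1, abs_of_nonneg (by positivity)] at hlim
  refine (ge_of_tendsto hlim ?_).trans_eq (by ring)
  filter_upwards [eventually_gt_atTop 0] with n hn
  have hn' : (n : ℝ) ≠ 0 := by positivity
  have h1 := one_sub_legendre_cos_mul_le l n (θ / n)
  rw [mul_div_cancel₀ _ hn'] at h1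
  have h2 : 1 - (legendre l).eval (Real.cos (θ / n)) =
      (1 - Real.cos (θ / n)) * Q.eval (Real.cos (θ / n)) := by
    have := congrArg (fun p => p.eval (Real.cos (θ / n))) hQ
    simp only [eval_sub, eval_one, eval_mul, eval_X, eval_C] at this
    linarith
  have h3 : 1 - Real.cos (θ / n) ≤ (θ / n) ^ 2 / 2 := by
    linarith [Real.one_sub_sq_div_two_le_cos (x := θ / n)]
  have h4 : 0 ≤ 1 - Real.cos (θ / n) := by linarith [Real.cos_le_one (θ / n)]
  calc _ ≤ _ := h1
    _ = (n : ℝ) ^ 2 * ((1 - Real.cos (θ / n)) * Q.eval (Real.cos (θ / n))) := by rw [h2]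
    _ ≤ (n : ℝ) ^ 2 * ((θ / n) ^ 2 / 2 * |Q.eval (Real.cos (θ / n))|) := by
        have := le_abs_self (Q.eval (Real.cos (θ / n)))
        exact mul_le_mul_of_nonneg_left ((mul_le_mul_of_nonneg_left this h4).trans
          (mul_le_mul_of_nonneg_right h3 (abs_nonneg _))) (by positivity)
    _ = _ := by field_simp

/-- Interpolated modulus of continuity of the Legendre polynomials at `1`. -/
theorem one_sub_legendre_inner_le (l : ℕ) (hl : 1 ≤ l) (x y : S2) {β : ℝ} (hβ₀ : 0 < β)
    (hβ₂ : β ≤ 2) :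
    1 - (legendre l).eval (inner ℝ (x : E3) (y : E3)) ≤
      2 * (l : ℝ) ^ β * geodesicDist x y ^ β := by
  set θ := geodesicDist x y with hθ
  have hθ0 : 0 ≤ θ := geodesicDist_nonneg x y
  have hl' : (1 : ℝ) ≤ l := by exact_mod_cast hl
  have h1 := one_sub_legendre_cos_le l θ
  rw [hθ, cos_geodesicDist, ← hθ] at h1
  have h2 : 1 - (legendre l).eval (inner ℝ (x : E3) (y : E3)) ≤ 2 := by
    linarith [(abs_le.1 (abs_legendre_inner_le_one l x y)).1]
  rw [mul_assoc, ← Real.mul_rpow (by positivity) hθ0]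
  -- Below lθ = 1 the quadratic bound is used with l(l+1) ≤ 2l²; above it the trivial bound 2.
  rcases le_total (l * θ) 1 with h | h
  · have h3 : (l * θ) ^ (2 : ℝ) ≤ (l * θ) ^ β := by
      rcases (show 0 ≤ l * θ by positivity).eq_or_lt with h0 | h0
      · rw [← h0, Real.zero_rpow hβ₀.ne', Real.zero_rpow two_ne_zero]
      · exact Real.rpow_le_rpow_of_exponent_ge h0 h hβ₂
    rw [Real.rpow_two] at h3
    nlinarith [sq_nonneg θ]
  · have h3 : 1 ≤ (l * θ) ^ β := Real.one_le_rpow h hβ₀.le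
    linarith

/-! ### Expansion in Legendre polynomials -/

open Polynomial in
theorem exists_legendre_expansion (n : ℕ) : ∀ q : ℝ[X], q.degree < n →
    ∃ a : ℕ → ℝ, q = ∑ l ∈ Finset.range n, C (a l) * legendre l := by
  induction n with
  | zero =>
    intro q hq
    refine ⟨0, ?_⟩
    rw [Finset.sum_range_zero]
    exact degree_eq_bot.1 (by simpa using hq)
  | succ n ih =>
    intro q hq
    have hlead := coeff_legendre_ne_zero n
    set c := q.coeff n / (legendre n).coeff n with hc
    obtain ⟨a, ha⟩ := ih (q - C c * legendre n) (by
      rw [degree_lt_iff_coeff_zero] at hq ⊢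
      intro m hm
      rw [coeff_sub, coeff_C_mul]
      rcases hm.eq_or_lt with rfl | hm
      · rw [hc]; field_simp; ring
      · rw [hq m (by exact_mod_cast hm),
          coeff_eq_zero_of_natDegree_lt ((degree_legendre_le n).trans_lt hm)]
        ring)
    refine ⟨Function.update a n c, ?_⟩
    rw [Finset.sum_range_succ, Function.update_self, eq_add_of_sub_eq ha]
    congr 1
    refine Finset.sum_congr rfl fun l hl => ?_
    rw [Function.update_of_ne (Finset.mem_range.1 hl).ne]

lemma integral_legendre_inner_mul_legendre_inner {l m : ℕ} (h : l ≠ m) (e : S2) :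
    ∫ z : S2, (legendre l).eval (inner ℝ (z : E3) (e : E3)) *
      (legendre m).eval (inner ℝ (z : E3) (e : E3)) ∂surfaceMeasure = 0 := by
  have key : ∀ {l m : ℕ}, m < l → ∫ z : S2, (legendre l).eval (inner ℝ (z : E3) (e : E3)) *
      (legendre m).eval (inner ℝ (z : E3) (e : E3)) ∂surfaceMeasure = 0 := fun {l m} hml =>
    integral_legendre_inner_mul_eq_zero l ((Polynomial.degree_le_of_natDegree_le
      (degree_legendre_le m)).trans_lt (by exact_mod_cast hml)) e
  rcases h.lt_or_gt with h | h
  · simpa only [mul_comm] using key h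
  · exact key h

theorem coeff_legendre_expansion (n : ℕ) (a : ℕ → ℝ) (q : Polynomial ℝ)
    (hq : q = ∑ l ∈ Finset.range n, Polynomial.C (a l) * legendre l) {m : ℕ} (hm : m < n)
    (e : S2) :
    a m = (2 * m + 1) / (4 * Real.pi) * ∫ z : S2, q.eval (inner ℝ (z : E3) (e : E3)) *
      (legendre m).eval (inner ℝ (z : E3) (e : E3)) ∂surfaceMeasure := by
  have h1 : ∀ z : S2, q.eval (inner ℝ (z : E3) (e : E3)) *
      (legendre m).eval (inner ℝ (z : E3) (e : E3)) = ∑ l ∈ Finset.range n, a l *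
      ((legendre l).eval (inner ℝ (z : E3) (e : E3)) *
      (legendre m).eval (inner ℝ (z : E3) (e : E3))) := by
    intro z
    rw [hq, Polynomial.eval_finsetSum, Finset.sum_mul]
    simp only [Polynomial.eval_mul, Polynomial.eval_C, mul_assoc]
  rw [integral_congr_ae (.of_forall h1), integral_finsetSum _ fun l _ =>
    integrable_of_continuous (by fun_prop)]
  simp only [integral_const_mul]
  rw [Finset.sum_eq_single m (fun l _ hl => by
    rw [integral_legendre_inner_mul_legendre_inner hl, mul_zero])
    (fun h => absurd (Finset.mem_range.2 hm) h), integral_legendre_inner_sq]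
  have := Real.pi_pos
  field_simp

/-! ### A polynomial approximate identity -/

/-- The polynomials `(n + 1) / (4π) ((1 + t) / 2) ^ n`, whose zonal functions concentrate at the
pole. -/
def bump (n : ℕ) : Polynomial ℝ :=
  Polynomial.C ((n + 1) / (4 * Real.pi)) * (Polynomial.C (1 / 2) * (1 + Polynomial.X)) ^ n

lemma eval_bump (n : ℕ) (t : ℝ) :
    (bump n).eval t = (n + 1) / (4 * Real.pi) * ((1 + t) / 2) ^ n := by
  simp only [bump, Polynomial.eval_mul, Polynomial.eval_C, Polynomial.eval_pow,
    Polynomial.eval_add, Polynomial.eval_one, Polynomial.eval_X]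
  ring

lemma eval_bump_nonneg (n : ℕ) (x y : S2) : 0 ≤ (bump n).eval (inner ℝ (x : E3) (y : E3)) := by
  rw [eval_bump]
  have := (inner_mem_Icc x y).1
  have : 0 ≤ (1 + inner ℝ (x : E3) (y : E3)) / 2 := by linarith
  positivity

lemma degree_bump_lt (n : ℕ) : (bump n).degree < (n + 1 : ℕ) := by
  refine (Polynomial.degree_le_of_natDegree_le (n := n) ?_).trans_lt
    (by exact_mod_cast Nat.lt_succ_self n)
  refine (Polynomial.natDegree_C_mul_le _ _).trans ?_
  have h : (Polynomial.C (1 / 2 : ℝ) * (1 + Polynomial.X)).natDegree ≤ 1 :=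
    (Polynomial.natDegree_C_mul_le _ _).trans (by compute_degree)
  simpa using Polynomial.natDegree_pow_le_of_le n h

theorem integral_bump (n : ℕ) (x : S2) :
    ∫ z : S2, (bump n).eval (inner ℝ (z : E3) (x : E3)) ∂surfaceMeasure = 1 := by
  rw [integral_eval_inner]
  have h : ∀ t ∈ Set.uIcc (-1 : ℝ) 1,
      HasDerivAt (fun t : ℝ => 1 / (2 * Real.pi) * ((1 + t) / 2) ^ (n + 1))
        ((bump n).eval t) t := by
    intro t _
    rw [eval_bump]
    have h1 : HasDerivAt (fun t : ℝ => (1 + t) / 2) (1 / 2) t :=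
      ((hasDerivAt_id t).const_add 1).div_const 2
    refine ((h1.pow (n + 1)).const_mul (1 / (2 * Real.pi))).congr_deriv ?_
    rw [Nat.add_sub_cancel]
    push_cast
    field_simp
    ring
  rw [intervalIntegral.integral_eq_sub_of_hasDerivAt h (intervalIntegrable_eval _ _ _)]
  have := Real.pi_pos
  norm_num
  field_simp

lemma bump_le_of_le_dist {n : ℕ} {δ : ℝ} {x y : S2} (hδ : 0 ≤ δ) (h : δ ≤ dist x y) :
    (bump n).eval (inner ℝ (x : E3) (y : E3)) ≤
      (n + 1) / (4 * Real.pi) * (1 - δ ^ 2 / 4) ^ n := by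
  rw [eval_bump]
  have h1 := dist_sq_eq x y
  have h2 : δ ^ 2 ≤ dist x y ^ 2 := by gcongr
  have h3 := (inner_mem_Icc x y).1
  have h4 : 0 ≤ (1 + inner ℝ (x : E3) (y : E3)) / 2 := by linarith
  gcongr
  linarith

lemma continuous_inner_prod :
    Continuous fun w : S2 × S2 => inner ℝ (w.1 : E3) (w.2 : E3) := by fun_prop

lemma measurable_bump_prod (n : ℕ) : Measurable fun w : S2 × S2 =>
    ENNReal.ofReal ((bump n).eval (inner ℝ (w.1 : E3) (w.2 : E3))) :=
  ((bump n).continuous.comp continuous_inner_prod).measurable.ennreal_ofReal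

lemma lintegral_bump (n : ℕ) (x : S2) :
    ∫⁻ z : S2, ENNReal.ofReal ((bump n).eval (inner ℝ (z : E3) (x : E3))) ∂surfaceMeasure = 1 := by
  rw [← ofReal_integral_eq_lintegral_ofReal (integrable_of_continuous (by fun_prop))
    (.of_forall fun z => eval_bump_nonneg n z x), integral_bump, ENNReal.ofReal_one]

lemma measurable_fst_mul_bump (n : ℕ) {h : S2 → ℝ≥0∞} (hh : Measurable h) :
    Measurable fun w : S2 × S2 =>
      h w.1 * ENNReal.ofReal ((bump n).eval (inner ℝ (w.1 : E3) (w.2 : E3))) :=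
  (hh.comp measurable_fst).mul (measurable_bump_prod n)

lemma measurable_snd_mul_bump (n : ℕ) {h : S2 → ℝ≥0∞} (hh : Measurable h) :
    Measurable fun w : S2 × S2 =>
      h w.2 * ENNReal.ofReal ((bump n).eval (inner ℝ (w.1 : E3) (w.2 : E3))) :=
  (hh.comp measurable_snd).mul (measurable_bump_prod n)

lemma measurable_bump_inner (n : ℕ) (x : S2) : Measurable fun z : S2 =>
    ENNReal.ofReal ((bump n).eval (inner ℝ (z : E3) (x : E3))) :=
  ((bump n).continuous.comp (continuous_inner_sphere x)).measurable.ennreal_ofReal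

lemma lintegral_fst_mul_bump (n : ℕ) {h : S2 → ℝ≥0∞} (hh : Measurable h) :
    ∫⁻ w : S2 × S2, h w.1 * ENNReal.ofReal ((bump n).eval (inner ℝ (w.1 : E3) (w.2 : E3)))
      ∂surfaceMeasure.prod surfaceMeasure = ∫⁻ x, h x ∂surfaceMeasure := by
  rw [lintegral_prod _ (measurable_fst_mul_bump n hh).aemeasurable]
  refine lintegral_congr fun x => ?_
  simp only [real_inner_comm _ (x : E3)]
  rw [lintegral_const_mul _ (measurable_bump_inner n x), lintegral_bump, mul_one]

lemma lintegral_snd_mul_bump (n : ℕ) {h : S2 → ℝ≥0∞} (hh : Measurable h) :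
    ∫⁻ w : S2 × S2, h w.2 * ENNReal.ofReal ((bump n).eval (inner ℝ (w.1 : E3) (w.2 : E3)))
      ∂surfaceMeasure.prod surfaceMeasure = ∫⁻ x, h x ∂surfaceMeasure := by
  rw [lintegral_prod_symm _ (measurable_snd_mul_bump n hh).aemeasurable]
  refine lintegral_congr fun x => ?_
  simp only
  rw [lintegral_const_mul _ (measurable_bump_inner n x), lintegral_bump, mul_one]

/-- The mean square oscillation of a function at the scale of the `n`-th bump. -/
def oscillation (n : ℕ) (f : S2 → ℝ) : ℝ≥0∞ :=
  ∫⁻ w : S2 × S2, ‖f w.1 - f w.2‖ₑ ^ 2 *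
    ENNReal.ofReal ((bump n).eval (inner ℝ (w.1 : E3) (w.2 : E3)))
    ∂surfaceMeasure.prod surfaceMeasure

lemma enorm_sub_sq_le (a b : ℝ) : ‖a - b‖ₑ ^ 2 ≤ 2 * ‖a‖ₑ ^ 2 + 2 * ‖b‖ₑ ^ 2 := by
  simp only [← ofReal_norm, Real.norm_eq_abs]
  rw [← ENNReal.ofReal_pow (abs_nonneg _), ← ENNReal.ofReal_pow (abs_nonneg _),
    ← ENNReal.ofReal_pow (abs_nonneg _), ← ENNReal.ofReal_ofNat 2,
    ← ENNReal.ofReal_mul two_pos.le, ← ENNReal.ofReal_mul two_pos.le,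
    ← ENNReal.ofReal_add (by positivity) (by positivity)]
  refine ENNReal.ofReal_le_ofReal ?_
  rw [sq_abs, sq_abs, sq_abs]
  nlinarith [sq_nonneg (a + b)]

lemma oscillation_le (n : ℕ) {f : S2 → ℝ} (hf : Measurable f) :
    oscillation n f ≤ 4 * ∫⁻ x, ‖f x‖ₑ ^ 2 ∂surfaceMeasure := by
  have hm : Measurable fun x => 2 * ‖f x‖ₑ ^ 2 := (hf.enorm.pow_const 2).const_mul 2
  calc oscillation n f
      ≤ ∫⁻ w : S2 × S2, (2 * ‖f w.1‖ₑ ^ 2 *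
          ENNReal.ofReal ((bump n).eval (inner ℝ (w.1 : E3) (w.2 : E3))) + 2 * ‖f w.2‖ₑ ^ 2 *
          ENNReal.ofReal ((bump n).eval (inner ℝ (w.1 : E3) (w.2 : E3))))
          ∂surfaceMeasure.prod surfaceMeasure := by
        refine lintegral_mono fun w => ?_
        rw [← add_mul]
        gcongr
        exact enorm_sub_sq_le _ _
    _ = _ := by
        rw [lintegral_add_left (measurable_fst_mul_bump n hm),
          lintegral_fst_mul_bump n hm, lintegral_snd_mul_bump n hm,
          lintegral_const_mul _ (hf.enorm.pow_const 2), ← two_mul, ← mul_assoc]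
        norm_num

lemma oscillation_add_le (n : ℕ) {f g : S2 → ℝ} (hf : Measurable f) (hg : Measurable g) :
    oscillation n f ≤ 2 * oscillation n (f - g) + 2 * oscillation n g := by
  have hm : ∀ {h : S2 → ℝ}, Measurable h → Measurable fun w : S2 × S2 => ‖h w.1 - h w.2‖ₑ ^ 2 *
      ENNReal.ofReal ((bump n).eval (inner ℝ (w.1 : E3) (w.2 : E3))) := fun hh =>
    (((hh.comp measurable_fst).sub (hh.comp measurable_snd)).enorm.pow_const 2).mul
      (measurable_bump_prod n)
  rw [oscillation, oscillation, oscillation, ← lintegral_const_mul _ (hm (hf.sub hg)),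
    ← lintegral_const_mul _ (hm hg), ← lintegral_add_left ((hm (hf.sub hg)).const_mul 2)]
  refine lintegral_mono fun w => ?_
  rw [← mul_assoc, ← mul_assoc, ← add_mul]
  gcongr
  have := enorm_sub_sq_le ((f - g) w.1 - (f - g) w.2) (g w.2 - g w.1)
  rw [enorm_sub_rev (g w.2)] at this
  refine le_trans (le_of_eq ?_) this
  congr 2
  simp only [Pi.sub_apply]
  ring

/-- Near the diagonal uniform continuity applies and the bump has mass one. Away from it the bump is
at most a multiple of (n+1)ρⁿ with ρ < 1. -/
lemma tendsto_oscillation_of_continuous {g : S2 → ℝ} (hg : Continuous g) :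
    Tendsto (fun n => oscillation n g) atTop (𝓝 0) := by
  obtain ⟨B, hB⟩ : ∃ B, ∀ x, ‖g x‖ ≤ B := by
    obtain ⟨B, hB⟩ := isCompact_univ.exists_bound_of_continuousOn hg.continuousOn
    exact ⟨B, fun x => hB x trivial⟩
  have hm2 : ENNReal.ofReal 1 * surfaceMeasure Set.univ ≠ ∞ :=
    ENNReal.mul_ne_top ENNReal.ofReal_ne_top (measure_ne_top _ _)
  have key : ∀ ε : ℝ, 0 < ε → ∀ᶠ n in atTop, oscillation n g ≤
      ENNReal.ofReal ε * (surfaceMeasure Set.univ +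
        (surfaceMeasure.prod surfaceMeasure) Set.univ) := by
    intro ε hε
    obtain ⟨δ, hδ, hδg⟩ := Metric.uniformContinuous_iff.1
      (CompactSpace.uniformContinuous_of_continuous hg) (Real.sqrt ε) (Real.sqrt_pos.2 hε)
    -- Truncating δ at 1 keeps ρ nonnegative.
    set ρ := 1 - (min δ 1) ^ 2 / 4 with hρ
    have hmin : 0 < min δ 1 := lt_min hδ one_pos
    have hmin1 : min δ 1 ≤ 1 := min_le_right _ _
    have hρ0 : 0 ≤ ρ := by nlinarith
    have hρ1 : ρ < 1 := by nlinarith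
    have hlim : Tendsto (fun n : ℕ => (2 * B) ^ 2 * ((n + 1) / (4 * Real.pi) * ρ ^ n)) atTop
        (𝓝 0) := by
      have h1 := (tendsto_self_mul_const_pow_of_lt_one hρ0 hρ1).add
        (tendsto_pow_atTop_nhds_zero_of_lt_one hρ0 hρ1)
      have h2 := h1.const_mul ((2 * B) ^ 2 / (4 * Real.pi))
      rw [add_zero, mul_zero] at h2
      refine h2.congr fun n => ?_
      ring
    filter_upwards [hlim.eventually (gt_mem_nhds hε)] with n hn
    have hpt : ∀ w : S2 × S2, ‖g w.1 - g w.2‖ₑ ^ 2 *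
        ENNReal.ofReal ((bump n).eval (inner ℝ (w.1 : E3) (w.2 : E3))) ≤
        ENNReal.ofReal ε * ENNReal.ofReal ((bump n).eval (inner ℝ (w.1 : E3) (w.2 : E3))) +
          ENNReal.ofReal ε := by
      intro w
      have hb := eval_bump_nonneg n w.1 w.2
      rw [← ofReal_norm, ← ENNReal.ofReal_pow (norm_nonneg _),
        ← ENNReal.ofReal_mul (by positivity), ← ENNReal.ofReal_mul hε.le,
        ← ENNReal.ofReal_add (by positivity) hε.le]
      refine ENNReal.ofReal_le_ofReal ?_
      rcases lt_or_ge (dist w.1 w.2) (min δ 1) with hd | hd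
      · have h1 := hδg (hd.trans_le (min_le_left _ _))
        rw [dist_eq_norm] at h1
        have h2 : ‖g w.1 - g w.2‖ ^ 2 ≤ ε := by
          rw [← Real.sq_sqrt hε.le]
          exact pow_le_pow_left₀ (norm_nonneg _) h1.le 2
        have := mul_le_mul_of_nonneg_right h2 hb
        linarith
      · have h1 : ‖g w.1 - g w.2‖ ≤ 2 * B := by
          linarith [norm_sub_le (g w.1) (g w.2), hB w.1, hB w.2]
        have h2 := bump_le_of_le_dist (n := n) hmin.le hd
        rw [← hρ] at h2
        have h3 : ‖g w.1 - g w.2‖ ^ 2 * (bump n).eval (inner ℝ (w.1 : E3) (w.2 : E3)) ≤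
            (2 * B) ^ 2 * ((n + 1) / (4 * Real.pi) * ρ ^ n) := by gcongr
        have h4 : 0 ≤ ε * (bump n).eval (inner ℝ (w.1 : E3) (w.2 : E3)) := by positivity
        linarith
    refine (lintegral_mono hpt).trans (le_of_eq ?_)
    rw [lintegral_add_right _ measurable_const, lintegral_fst_mul_bump n
      (measurable_const (a := ENNReal.ofReal ε)), lintegral_const, lintegral_const, mul_add]
  set A := surfaceMeasure Set.univ + (surfaceMeasure.prod surfaceMeasure) Set.univ with hA
  have hAtop : A ≠ ∞ := ENNReal.add_ne_top.2 ⟨measure_ne_top _ _, measure_ne_top _ _⟩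
  rw [ENNReal.tendsto_nhds_zero]
  intro ε hε
  have h0 : Tendsto (fun r : ℝ => ENNReal.ofReal r * A) (𝓝[>] 0) (𝓝 (ENNReal.ofReal 0 * A)) :=
    ENNReal.Tendsto.mul_const (ENNReal.tendsto_ofReal (tendsto_id.mono_left nhdsWithin_le_nhds))
      (Or.inr hAtop)
  rw [ENNReal.ofReal_zero, zero_mul] at h0
  obtain ⟨r, hr1, hr2⟩ := ((ENNReal.tendsto_nhds_zero.1 h0 ε hε).and self_mem_nhdsWithin).exists
  filter_upwards [key r hr2] with n hn using hn.trans hr1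

/-- Continuous functions are dense in L², and the oscillation is bounded by 4‖·‖² uniformly in n.
The factor 8 below is this 4 times the 2 lost in splitting f = (f - g) + g. -/
theorem tendsto_oscillation {f : S2 → ℝ} (hf : Measurable f)
    (hf2 : ∫⁻ x, ‖f x‖ₑ ^ 2 ∂surfaceMeasure ≠ ∞) :
    Tendsto (fun n => oscillation n f) atTop (𝓝 0) := by
  have hL : ∀ h : S2 → ℝ, eLpNorm h 2 surfaceMeasure ^ 2 =
      ∫⁻ x, ‖h x‖ₑ ^ 2 ∂surfaceMeasure := by
    intro h
    have := eLpNorm_nnreal_pow_eq_lintegral (f := h) (μ := surfaceMeasure) (p := 2) two_ne_zero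
    simpa using this
  have hmem : MemLp f 2 surfaceMeasure := by
    refine ⟨hf.aestronglyMeasurable, ?_⟩
    rw [← hL] at hf2
    exact lt_top_iff_ne_top.2 fun h => hf2 (by simp [h])
  rw [ENNReal.tendsto_nhds_zero]
  intro ε hε
  obtain ⟨η, hη0, hη⟩ : ∃ η : ℝ≥0∞, η ≠ 0 ∧ 8 * η ^ 2 ≤ ε / 2 := by
    have h0 : Tendsto (fun η : ℝ≥0∞ => 8 * η ^ 2) (𝓝[>] 0) (𝓝 (8 * 0 ^ 2)) :=
      ENNReal.Tendsto.const_mul ((ENNReal.continuous_pow 2).tendsto' _ _ rfl |>.mono_left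
        nhdsWithin_le_nhds) (Or.inr (by norm_num))
    rw [zero_pow two_ne_zero, mul_zero] at h0
    obtain ⟨η, h1, h2⟩ := ((ENNReal.tendsto_nhds_zero.1 h0 (ε / 2)
      (ENNReal.half_pos hε.ne')).and self_mem_nhdsWithin).exists
    exact ⟨η, (Set.mem_Ioi.1 h2).ne', h1⟩
  obtain ⟨g, hg, -⟩ := hmem.exists_boundedContinuous_eLpNorm_sub_le ENNReal.ofNat_ne_top hη0
  have h2 := ENNReal.Tendsto.const_mul (a := 2) (tendsto_oscillation_of_continuous g.continuous)
    (Or.inr (by norm_num))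
  rw [mul_zero] at h2
  filter_upwards [ENNReal.tendsto_nhds_zero.1 h2 (ε / 2) (ENNReal.half_pos hε.ne')] with n hn
  have hgm := g.continuous.measurable
  calc oscillation n f ≤ 2 * oscillation n (f - g) + 2 * oscillation n g :=
        oscillation_add_le n hf hgm
    _ ≤ 2 * (4 * ∫⁻ x, ‖(f - g) x‖ₑ ^ 2 ∂surfaceMeasure) + ε / 2 := by
        gcongr
        exact oscillation_le n (hf.sub hgm)
    _ ≤ 8 * η ^ 2 + ε / 2 := by
        rw [← hL, ← mul_assoc]
        norm_num
        gcongr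
    _ ≤ ε := by
        refine (add_le_add_left hη _).trans ?_
        rw [ENNReal.add_halves]

/-! ### Covariance of an isotropic field -/

section Covariance

variable {Ω : Type*} [MeasurableSpace Ω] {P : Measure Ω} {T : Ω → S2 → ℝ}

lemma IsRandomField.measurable_eval (hT : IsRandomField T) (x : S2) :
    Measurable fun ω => T ω x :=
  Measurable.comp hT measurable_prodMk_right

lemma IsRandomField.measurable_path (hT : IsRandomField T) (ω : Ω) : Measurable (T ω) :=
  Measurable.comp (g := fun p : Ω × S2 => T p.1 p.2) hT measurable_prodMk_left

/-- The (uncentred) covariance function of a field, as a function of the inner product. -/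
def covKernel (P : Measure Ω) (T : Ω → S2 → ℝ) (t : ℝ) : ℝ :=
  ∫ ω, T ω (circlePoint 0) * T ω (circlePoint (Real.arccos t)) ∂P

lemma integral_mul_eq_covKernel (hI : IsWeaklyIsotropic 2 P T) (x y : S2) :
    ∫ ω, T ω x * T ω y ∂P = covKernel P T (inner ℝ (x : E3) (y : E3)) := by
  have h : inner ℝ (x : E3) (y : E3) = inner ℝ (circlePoint 0 : E3)
      (circlePoint (Real.arccos (inner ℝ (x : E3) (y : E3))) : E3) := by
    rw [inner_circlePoint, zero_sub, Real.cos_neg,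
      Real.cos_arccos (inner_mem_Icc x y).1 (inner_mem_Icc x y).2]
  obtain ⟨g, hg, h0, h1⟩ := exists_rotation_of_inner_eq h
  have := hI.moments 2 one_le_two le_rfl ![x, y] g hg
  simpa [covKernel, Fin.prod_univ_two, h0, h1] using this

lemma integral_eq_integral_of_isotropic (hI : IsWeaklyIsotropic 2 P T) (x y : S2) :
    ∫ ω, T ω x ∂P = ∫ ω, T ω y ∂P := by
  obtain ⟨g, hg, h0, -⟩ := exists_rotation_of_inner_eq (x := x) (y := x) (x' := y) (y' := y)
    (by rw [inner_self_sphere, inner_self_sphere])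
  have := hI.moments 1 le_rfl one_le_two ![x] g hg
  simpa [h0] using this

lemma memLp_two_eval (hR : IsRandomField T) (hI : IsWeaklyIsotropic 2 P T) (x : S2) :
    MemLp (fun ω => T ω x) 2 P := by
  rw [memLp_two_iff_integrable_sq (hR.measurable_eval x).aestronglyMeasurable]
  simpa only [sq_abs] using hI.integrable x

lemma integrable_mul_eval (hR : IsRandomField T) (hI : IsWeaklyIsotropic 2 P T) (x y : S2) :
    Integrable (fun ω => T ω x * T ω y) P :=
  (memLp_two_eval hR hI x).integrable_mul (memLp_two_eval hR hI y)

lemma integrable_sq_eval (hR : IsRandomField T) (hI : IsWeaklyIsotropic 2 P T) (x : S2) :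
    Integrable (fun ω => T ω x ^ 2) P := (memLp_two_eval hR hI x).integrable_sq

lemma integral_sq_eval (hI : IsWeaklyIsotropic 2 P T) (x : S2) :
    ∫ ω, T ω x ^ 2 ∂P = covKernel P T 1 := by
  simp only [sq]
  rw [integral_mul_eq_covKernel hI, inner_self_sphere]

lemma integrable_sub_sq (hR : IsRandomField T) (hI : IsWeaklyIsotropic 2 P T) (x y : S2) :
    Integrable (fun ω => (T ω x - T ω y) ^ 2) P :=
  ((memLp_two_eval hR hI x).sub (memLp_two_eval hR hI y)).integrable_sq

theorem integral_sub_sq (hR : IsRandomField T) (hI : IsWeaklyIsotropic 2 P T) (x y : S2) :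
    ∫ ω, (T ω x - T ω y) ^ 2 ∂P =
      2 * (covKernel P T 1 - covKernel P T (inner ℝ (x : E3) (y : E3))) := by
  have h : ∀ ω, (T ω x - T ω y) ^ 2 = T ω x ^ 2 + T ω y ^ 2 - 2 * (T ω x * T ω y) := fun ω => by
    ring
  have hadd : Integrable (fun ω => T ω x ^ 2 + T ω y ^ 2) P :=
    (integrable_sq_eval hR hI x).add (integrable_sq_eval hR hI y)
  rw [integral_congr_ae (.of_forall h), integral_sub hadd ((integrable_mul_eval hR hI x y).const_mul 2),
    integral_add (integrable_sq_eval hR hI x) (integrable_sq_eval hR hI y), integral_const_mul,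
    integral_sq_eval hI, integral_sq_eval hI, integral_mul_eq_covKernel hI]
  ring

lemma integral_abs_mul_le (hR : IsRandomField T) (hI : IsWeaklyIsotropic 2 P T) (x y : S2) :
    ∫ ω, |T ω x * T ω y| ∂P ≤ covKernel P T 1 := by
  calc ∫ ω, |T ω x * T ω y| ∂P ≤ ∫ ω, (1 / 2) * (T ω x ^ 2 + T ω y ^ 2) ∂P := by
        refine integral_mono (integrable_mul_eval hR hI x y).abs
          (((integrable_sq_eval hR hI x).add (integrable_sq_eval hR hI y)).const_mul _) fun ω => ?_
        change |T ω x * T ω y| ≤ 1 / 2 * (T ω x ^ 2 + T ω y ^ 2)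
        rw [abs_le]
        constructor <;> nlinarith [sq_nonneg (T ω x - T ω y), sq_nonneg (T ω x + T ω y)]
    _ = _ := by
        rw [integral_const_mul, integral_add (integrable_sq_eval hR hI x)
          (integrable_sq_eval hR hI y), integral_sq_eval hI, integral_sq_eval hI]
        ring

lemma continuous_circlePoint : Continuous circlePoint := by
  refine Continuous.subtype_mk ?_ _
  refine (PiLp.continuous_toLp 2 _).comp (continuous_pi fun i => ?_)
  fin_cases i <;> simp <;> fun_prop

lemma isBoundedKernel_covKernel [SFinite P] (hR : IsRandomField T)
    (hI : IsWeaklyIsotropic 2 P T) : IsBoundedKernel (covKernel P T) := by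
  refine ⟨?_, covKernel P T 1, fun t _ =>
    (abs_integral_le_integral_abs).trans (integral_abs_mul_le hR hI _ _)⟩
  have hm : Measurable fun w : ℝ × Ω =>
      T w.2 (circlePoint 0) * T w.2 (circlePoint (Real.arccos w.1)) := by
    refine ((hR.measurable_eval _).comp measurable_snd).mul (Measurable.comp (g :=
      fun p : Ω × S2 => T p.1 p.2) hR (measurable_snd.prodMk
      ((continuous_circlePoint.comp Real.continuous_arccos).measurable.comp measurable_fst)))
  exact (hm.stronglyMeasurable.integral_prod_right (ν := P)).measurable

/-! ### Mean square continuity -/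

theorem lintegral_enorm_sub_sq (hR : IsRandomField T) (hI : IsWeaklyIsotropic 2 P T) (x y : S2) :
    ∫⁻ ω, ‖T ω x - T ω y‖ₑ ^ 2 ∂P =
      ENNReal.ofReal (2 * (covKernel P T 1 - covKernel P T (inner ℝ (x : E3) (y : E3)))) := by
  rw [← integral_sub_sq hR hI, ofReal_integral_eq_lintegral_ofReal (integrable_sub_sq hR hI x y)
    (.of_forall fun ω => sq_nonneg _)]
  refine lintegral_congr fun ω => ?_
  rw [← ofReal_norm, ← ENNReal.ofReal_pow (norm_nonneg _), Real.norm_eq_abs, sq_abs]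

lemma covKernel_le (hR : IsRandomField T) (hI : IsWeaklyIsotropic 2 P T) (x y : S2) :
    0 ≤ covKernel P T 1 - covKernel P T (inner ℝ (x : E3) (y : E3)) := by
  have : 0 ≤ ∫ ω, (T ω x - T ω y) ^ 2 ∂P := integral_nonneg fun ω => sq_nonneg _
  rw [integral_sub_sq hR hI] at this
  linarith

lemma measurable_oscillation_integrand (hR : IsRandomField T) (n : ℕ) :
    Measurable fun p : Ω × S2 × S2 => ‖T p.1 p.2.1 - T p.1 p.2.2‖ₑ ^ 2 *
      ENNReal.ofReal ((bump n).eval (inner ℝ (p.2.1 : E3) (p.2.2 : E3))) := by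
  have h1 : Measurable fun p : Ω × S2 × S2 => T p.1 p.2.1 := Measurable.comp
    (g := fun p : Ω × S2 => T p.1 p.2) hR (measurable_fst.prodMk (measurable_fst.comp measurable_snd))
  have h2 : Measurable fun p : Ω × S2 × S2 => T p.1 p.2.2 := Measurable.comp
    (g := fun p : Ω × S2 => T p.1 p.2) hR (measurable_fst.prodMk (measurable_snd.comp measurable_snd))
  exact ((h1.sub h2).enorm.pow_const 2).mul ((measurable_bump_prod n).comp measurable_snd)

/-- Dominated convergence over ω: the second moment of T(x) is finite and constant in x, so 4‖T(ω)‖²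
in L² is an integrable majorant, and almost every path is square integrable. -/
lemma tendsto_lintegral_oscillation [IsProbabilityMeasure P] (hR : IsRandomField T)
    (hI : IsWeaklyIsotropic 2 P T) :
    Tendsto (fun n => ∫⁻ ω, oscillation n (T ω) ∂P) atTop (𝓝 0) := by
  have hm : Measurable fun p : Ω × S2 => ‖T p.1 p.2‖ₑ ^ 2 := Measurable.pow_const
    (Measurable.enorm hR) 2
  have hfin : ∫⁻ ω, 4 * ∫⁻ x, ‖T ω x‖ₑ ^ 2 ∂surfaceMeasure ∂P ≠ ∞ := by
    rw [lintegral_const_mul _ hm.lintegral_prod_right', lintegral_lintegral_swap hm.aemeasurable]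
    have h : ∀ x, ∫⁻ ω, ‖T ω x‖ₑ ^ 2 ∂P = ENNReal.ofReal (covKernel P T 1) := by
      intro x
      rw [← integral_sq_eval hI x, ofReal_integral_eq_lintegral_ofReal (integrable_sq_eval hR hI x)
        (.of_forall fun ω => sq_nonneg _)]
      refine lintegral_congr fun ω => ?_
      rw [← ofReal_norm, ← ENNReal.ofReal_pow (norm_nonneg _), Real.norm_eq_abs, sq_abs]
    simp only [h, lintegral_const]
    exact ENNReal.mul_ne_top (by norm_num)
      (ENNReal.mul_ne_top ENNReal.ofReal_ne_top (measure_ne_top _ _))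
  have h0 : (0 : ℝ≥0∞) = ∫⁻ _ : Ω, 0 ∂P := by simp
  rw [h0]
  refine tendsto_lintegral_of_dominated_convergence
    (fun ω => 4 * ∫⁻ x, ‖T ω x‖ₑ ^ 2 ∂surfaceMeasure)
    (fun n => (measurable_oscillation_integrand hR n).lintegral_prod_right')
    (fun n => .of_forall fun ω => oscillation_le n (hR.measurable_path ω)) hfin ?_
  filter_upwards [ae_lt_top (hm.lintegral_prod_right'.const_mul 4) hfin] with ω hω
  refine tendsto_oscillation (hR.measurable_path ω) fun h => ?_
  simp [h] at hω

/-- Joint measurability and isotropy imply continuity of the covariance at the diagonal, in an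
averaged sense. -/
theorem tendsto_integral_covKernel_mul_bump [IsProbabilityMeasure P] (hR : IsRandomField T)
    (hI : IsWeaklyIsotropic 2 P T) (x : S2) :
    Tendsto (fun n => ∫ z : S2, (covKernel P T 1 - covKernel P T (inner ℝ (z : E3) (x : E3))) *
      (bump n).eval (inner ℝ (z : E3) (x : E3)) ∂surfaceMeasure) atTop (𝓝 0) := by
  have hk := isBoundedKernel_covKernel hR hI
  set I : ℕ → ℝ := fun n => ∫ z : S2,
    (covKernel P T 1 - covKernel P T (inner ℝ (z : E3) (x : E3))) *
      (bump n).eval (inner ℝ (z : E3) (x : E3)) ∂surfaceMeasure with hIdef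
  have hint : ∀ n (y : S2), Integrable (fun z : S2 =>
      (covKernel P T 1 - covKernel P T (inner ℝ (z : E3) (y : E3))) *
      (bump n).eval (inner ℝ (z : E3) (y : E3))) surfaceMeasure := by
    intro n y
    simp only [sub_mul]
    exact (integrable_of_continuous (by fun_prop)).sub (hk.integrable_mul y (by fun_prop))
  have hnn : ∀ n (y z : S2), 0 ≤ (covKernel P T 1 - covKernel P T (inner ℝ (z : E3) (y : E3))) *
      (bump n).eval (inner ℝ (z : E3) (y : E3)) := fun n y z =>
    mul_nonneg (covKernel_le hR hI z y) (eval_bump_nonneg n z y)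
  have hI0 : ∀ n, 0 ≤ I n := fun n => integral_nonneg (hnn n x)
  -- By Tonelli the expectation falls on (T(x) - T(y))², and rotation invariance makes the inner
  -- integral independent of the pole.
  have heq : ∀ n, ∫⁻ ω, oscillation n (T ω) ∂P =
      ENNReal.ofReal (2 * I n) * surfaceMeasure Set.univ := by
    intro n
    simp only [oscillation]
    rw [lintegral_lintegral_swap (measurable_oscillation_integrand hR n).aemeasurable]
    have h1 : ∀ w : S2 × S2, ∫⁻ ω, ‖T ω w.1 - T ω w.2‖ₑ ^ 2 *
        ENNReal.ofReal ((bump n).eval (inner ℝ (w.1 : E3) (w.2 : E3))) ∂P =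
        ENNReal.ofReal (2 * ((covKernel P T 1 - covKernel P T (inner ℝ (w.1 : E3) (w.2 : E3))) *
          (bump n).eval (inner ℝ (w.1 : E3) (w.2 : E3)))) := by
      intro w
      have hm : Measurable fun ω => ‖T ω w.1 - T ω w.2‖ₑ ^ 2 :=
        ((hR.measurable_eval _).sub (hR.measurable_eval _)).enorm.pow_const 2
      rw [lintegral_mul_const _ hm, lintegral_enorm_sub_sq hR hI,
        ← ENNReal.ofReal_mul (by linarith [covKernel_le hR hI w.1 w.2]), mul_assoc]
    simp only [h1]
    rw [lintegral_prod_symm]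
    · have h2 : ∀ y : S2, ∫⁻ z : S2, ENNReal.ofReal (2 * ((covKernel P T 1 -
          covKernel P T (inner ℝ (z : E3) (y : E3))) *
          (bump n).eval (inner ℝ (z : E3) (y : E3)))) ∂surfaceMeasure =
          ENNReal.ofReal (2 * I n) := by
        intro y
        rw [← ofReal_integral_eq_lintegral_ofReal ((hint n y).const_mul 2)
          (.of_forall fun z => mul_nonneg two_pos.le (hnn n y z)), integral_const_mul,
          integral_inner_congr (fun t => (covKernel P T 1 - covKernel P T t) * (bump n).eval t) y x]
      simp only [h2, lintegral_const]
    · have hc := continuous_inner_prod.measurable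
      exact (((measurable_const.sub (hk.measurable.comp hc)).mul
        ((bump n).continuous.measurable.comp hc)).const_mul 2).ennreal_ofReal.aemeasurable
  have hlim := tendsto_lintegral_oscillation hR hI
  simp only [heq] at hlim
  have hσ : surfaceMeasure Set.univ ≠ 0 := by
    intro h
    have := surfaceMeasure_real_univ
    rw [measureReal_def, h, ENNReal.toReal_zero] at this
    linarith [Real.pi_pos]
  have h3 := ENNReal.Tendsto.mul_const (b := (surfaceMeasure Set.univ)⁻¹) hlim
    (Or.inr (ENNReal.inv_ne_top.2 hσ))
  simp only [mul_assoc, ENNReal.mul_inv_cancel hσ (measure_ne_top _ _), mul_one, zero_mul] at h3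
  have h4 := (ENNReal.tendsto_toReal ENNReal.zero_ne_top).comp h3
  simp only [ENNReal.toReal_zero] at h4
  have h5 := h4.const_mul (1 / 2)
  rw [mul_zero] at h5
  refine h5.congr fun n => ?_
  rw [Function.comp_apply, ENNReal.toReal_ofReal (by linarith [hI0 n])]
  ring

/-- The zonal convolutions of the covariance with the bumps converge to the covariance at every
point. -/
theorem tendsto_covKernel_convolution_bump [IsProbabilityMeasure P] (hR : IsRandomField T)
    (hI : IsWeaklyIsotropic 2 P T) (x y : S2) :
    Tendsto (fun n => ∫ z : S2, covKernel P T (inner ℝ (z : E3) (y : E3)) *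
      (bump n).eval (inner ℝ (z : E3) (x : E3)) ∂surfaceMeasure) atTop
      (𝓝 (covKernel P T (inner ℝ (x : E3) (y : E3)))) := by
  have hk := isBoundedKernel_covKernel hR hI
  -- Young's inequality |T(z) - T(x)| |T(y)| ≤ (T(z) - T(x))²/(2η) + (η/2) T(y)², integrated over ω.
  -- It carries continuity at the diagonal over to every pair of points.
  have hpt : ∀ η : ℝ, 0 < η → ∀ z : S2, |covKernel P T (inner ℝ (z : E3) (y : E3)) -
      covKernel P T (inner ℝ (x : E3) (y : E3))| ≤
      (covKernel P T 1 - covKernel P T (inner ℝ (z : E3) (x : E3))) / η +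
        η / 2 * covKernel P T 1 := by
    intro η hη z
    rw [← integral_mul_eq_covKernel hI, ← integral_mul_eq_covKernel hI, ← integral_sub
      (integrable_mul_eval hR hI _ _) (integrable_mul_eval hR hI _ _)]
    refine abs_integral_le_integral_abs.trans ?_
    have hb := integral_sub_sq hR hI z x
    have e : (covKernel P T 1 - covKernel P T (inner ℝ (z : E3) (x : E3))) / η +
        η / 2 * covKernel P T 1 =
        ∫ ω, ((T ω z - T ω x) ^ 2 / (2 * η) + η / 2 * T ω y ^ 2) ∂P := by
      rw [integral_add ((integrable_sub_sq hR hI z x).div_const _)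
        ((integrable_sq_eval hR hI y).const_mul _), integral_div, hb, integral_const_mul,
        integral_sq_eval hI]
      field_simp
    rw [e]
    refine integral_mono ((integrable_mul_eval hR hI _ _).sub (integrable_mul_eval hR hI _ _)).abs
      (((integrable_sub_sq hR hI z x).div_const _).add
        ((integrable_sq_eval hR hI y).const_mul _)) fun ω => ?_
    change |T ω z * T ω y - T ω x * T ω y| ≤ (T ω z - T ω x) ^ 2 / (2 * η) + η / 2 * T ω y ^ 2
    have e2 : (T ω z - T ω x) ^ 2 / (2 * η) + η / 2 * T ω y ^ 2 =
        ((T ω z - T ω x) ^ 2 + (η * T ω y) ^ 2) / (2 * η) := by field_simp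
    rw [e2, le_div_iff₀ (by positivity), ← abs_of_pos (show 0 < 2 * η by positivity), ← abs_mul,
      abs_le]
    constructor <;>
      nlinarith [sq_nonneg (T ω z - T ω x - η * T ω y), sq_nonneg (T ω z - T ω x + η * T ω y)]
  have hmain : ∀ η : ℝ, 0 < η → ∀ n, |∫ z : S2, covKernel P T (inner ℝ (z : E3) (y : E3)) *
      (bump n).eval (inner ℝ (z : E3) (x : E3)) ∂surfaceMeasure -
      covKernel P T (inner ℝ (x : E3) (y : E3))| ≤
      (∫ z : S2, (covKernel P T 1 - covKernel P T (inner ℝ (z : E3) (x : E3))) *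
        (bump n).eval (inner ℝ (z : E3) (x : E3)) ∂surfaceMeasure) / η +
        η / 2 * covKernel P T 1 := by
    intro η hη n
    have hi1 : Integrable (fun z : S2 => covKernel P T (inner ℝ (z : E3) (y : E3)) *
      (bump n).eval (inner ℝ (z : E3) (x : E3))) surfaceMeasure :=
      hk.integrable_mul y (by fun_prop)
    have hi2 : Integrable (fun z : S2 => covKernel P T (inner ℝ (x : E3) (y : E3)) *
      (bump n).eval (inner ℝ (z : E3) (x : E3))) surfaceMeasure :=
      integrable_of_continuous (by fun_prop)
    have hi3 : Integrable (fun z : S2 =>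
        (covKernel P T 1 - covKernel P T (inner ℝ (z : E3) (x : E3))) *
        (bump n).eval (inner ℝ (z : E3) (x : E3))) surfaceMeasure := by
      simp only [sub_mul]
      exact (integrable_of_continuous (by fun_prop)).sub (hk.integrable_mul x (by fun_prop))
    have hi4 : Integrable (fun z : S2 => η / 2 * covKernel P T 1 *
        (bump n).eval (inner ℝ (z : E3) (x : E3))) surfaceMeasure :=
      integrable_of_continuous (by fun_prop)
    have e1 : covKernel P T (inner ℝ (x : E3) (y : E3)) =
        ∫ z : S2, covKernel P T (inner ℝ (x : E3) (y : E3)) *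
          (bump n).eval (inner ℝ (z : E3) (x : E3)) ∂surfaceMeasure := by
      rw [integral_const_mul, integral_bump, mul_one]
    have e2 : η / 2 * covKernel P T 1 = ∫ z : S2, η / 2 * covKernel P T 1 *
        (bump n).eval (inner ℝ (z : E3) (x : E3)) ∂surfaceMeasure := by
      rw [integral_const_mul, integral_bump, mul_one]
    rw [e2, ← integral_div, ← integral_add (hi3.div_const η) hi4]
    nth_rewrite 1 [e1]
    rw [← integral_sub hi1 hi2]
    refine abs_integral_le_integral_abs.trans (integral_mono (hi1.sub hi2).abs
      ((hi3.div_const η).add hi4) fun z => ?_)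
    simp only
    have hb := eval_bump_nonneg n z x
    rw [← sub_mul, abs_mul, abs_of_nonneg hb, ← div_mul_eq_mul_div₀, ← add_mul]
    exact mul_le_mul_of_nonneg_right (hpt η hη z) hb
  have hk1 : 0 ≤ covKernel P T 1 := by
    rw [← integral_sq_eval hI x]
    exact integral_nonneg fun ω => sq_nonneg _
  rw [Metric.tendsto_atTop']
  intro ε hε
  -- With this η the term (η/2) κ(1) stays below ε/2, uniformly in n; the bump average divided by η
  -- is eventually below ε/2.
  set η := ε / (covKernel P T 1 + 1) with hη
  have hη0 : 0 < η := by positivity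
  have hη1 : η * covKernel P T 1 < ε := by
    rw [hη, div_mul_eq_mul_div, div_lt_iff₀ (by positivity)]
    nlinarith
  have hev := (tendsto_integral_covKernel_mul_bump hR hI x).eventually
    (gt_mem_nhds (show 0 < η * (ε / 2) by positivity))
  obtain ⟨N, hN⟩ := eventually_atTop.1 hev
  refine ⟨N, fun n hn => ?_⟩
  rw [Real.dist_eq]
  refine (hmain η hη0 n).trans_lt ?_
  have h1 := hN n hn.le
  rw [← div_lt_iff₀' hη0] at h1
  linarith

end Covariance

/-! ### The angular power spectrum and the variance of increments -/

/-- The north pole. -/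
def northPole : S2 := ⟨EuclideanSpace.single 2 1, by simp⟩

lemma inner_northPole (y : S2) : inner ℝ (y : E3) (northPole : E3) = (y : E3) 2 := by
  simp [northPole, EuclideanSpace.inner_single_right]

lemma sphericalHarmonic_zero (l : ℕ) (y : S2) : sphericalHarmonic l 0 y =
    ((Real.sqrt ((2 * l + 1) / (4 * Real.pi)) *
      (legendre l).eval (inner ℝ (y : E3) (northPole : E3)) : ℝ) : ℂ) := by
  have : ((l.factorial : ℝ) / l.factorial) = 1 := div_self (by positivity)
  rw [inner_northPole]
  simp [sphericalHarmonic, sphericalHarmonicNonneg, assocLegendre, this]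

lemma klCoeff_zero {Ω : Type*} (T : Ω → S2 → ℝ) (l : ℕ) (ω : Ω) : klCoeff T l 0 ω =
    ((∫ y, T ω y * (Real.sqrt ((2 * l + 1) / (4 * Real.pi)) *
      (legendre l).eval (inner ℝ (y : E3) (northPole : E3))) ∂surfaceMeasure : ℝ) : ℂ) := by
  refine Eq.trans (integral_congr_ae (.of_forall fun y => ?_)) integral_complex_ofReal
  simp only [sphericalHarmonic_zero, map_mul, Complex.conj_ofReal, Complex.ofReal_mul]

section IncrementVariance

variable {Ω : Type*} [MeasurableSpace Ω] {P : Measure Ω} {T : Ω → S2 → ℝ}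

lemma angularPowerSpectrum_eq_integral_sq {l : ℕ} (hl : 1 ≤ l) : angularPowerSpectrum P T l =
    ∫ ω, (∫ y, T ω y * (Real.sqrt ((2 * l + 1) / (4 * Real.pi)) *
      (legendre l).eval (inner ℝ (y : E3) (northPole : E3))) ∂surfaceMeasure) ^ 2 ∂P := by
  rw [angularPowerSpectrum, if_neg (by omega), sub_zero]
  simp only [klCoeff_zero, Complex.conj_ofReal, ← Complex.ofReal_mul, sq]
  rw [integral_complex_ofReal, Complex.ofReal_re]

lemma angularPowerSpectrum_nonneg {l : ℕ} (hl : 1 ≤ l) : 0 ≤ angularPowerSpectrum P T l := by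
  rw [angularPowerSpectrum_eq_integral_sq hl]
  exact integral_nonneg fun ω => sq_nonneg _

/-- The second moment of a linear functional of an isotropic field. -/
theorem integral_sq_integral_mul [IsProbabilityMeasure P] (hR : IsRandomField T)
    (hI : IsWeaklyIsotropic 2 P T) {g : S2 → ℝ} (hg : Continuous g) :
    ∫ ω, (∫ y, T ω y * g y ∂surfaceMeasure) ^ 2 ∂P =
      ∫ x : S2, ∫ z : S2, covKernel P T (inner ℝ (z : E3) (x : E3)) * (g z * g x)
        ∂surfaceMeasure ∂surfaceMeasure := by
  have hk := isBoundedKernel_covKernel hR hI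
  obtain ⟨B, hB⟩ : ∃ B, ∀ x, ‖g x‖ ≤ B := by
    obtain ⟨B, hB⟩ := isCompact_univ.exists_bound_of_continuousOn hg.continuousOn
    exact ⟨B, fun x => hB x trivial⟩
  let F : Ω × S2 × S2 → ℝ := fun p => (T p.1 p.2.1 * g p.2.1) * (T p.1 p.2.2 * g p.2.2)
  have h1 : Measurable fun p : Ω × S2 × S2 => T p.1 p.2.1 := Measurable.comp
    (g := fun p : Ω × S2 => T p.1 p.2) hR (measurable_fst.prodMk (measurable_fst.comp measurable_snd))
  have h2 : Measurable fun p : Ω × S2 × S2 => T p.1 p.2.2 := Measurable.comp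
    (g := fun p : Ω × S2 => T p.1 p.2) hR (measurable_fst.prodMk (measurable_snd.comp measurable_snd))
  have hFm : Measurable F :=
    (h1.mul (hg.measurable.comp (measurable_fst.comp measurable_snd))).mul
      (h2.mul (hg.measurable.comp (measurable_snd.comp measurable_snd)))
  have hFe : ∀ (w : S2 × S2) ω, F (ω, w) = T ω w.1 * T ω w.2 * (g w.1 * g w.2) := fun w ω => by
    simp only [F]; ring
  have hFi : Integrable F (P.prod (surfaceMeasure.prod surfaceMeasure)) := by
    rw [integrable_prod_iff' hFm.aestronglyMeasurable]
    constructor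
    · refine .of_forall fun w => ?_
      simp only [hFe]
      exact (integrable_mul_eval hR hI _ _).mul_const _
    · refine Integrable.of_bound (C := covKernel P T 1 * (B * B))
        hFm.stronglyMeasurable.norm.integral_prod_left'.aestronglyMeasurable
        (.of_forall fun w => ?_)
      rw [Real.norm_of_nonneg (integral_nonneg fun ω => norm_nonneg _)]
      simp only [hFe, norm_mul]
      rw [integral_mul_const]
      have hb := integral_abs_mul_le hR hI w.1 w.2
      simp only [abs_mul] at hb
      have hB0 : 0 ≤ B := (norm_nonneg _).trans (hB w.1)
      have hk0 : 0 ≤ covKernel P T 1 :=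
        (integral_nonneg fun ω => by positivity).trans hb
      exact mul_le_mul hb (mul_le_mul (hB _) (hB _) (norm_nonneg _) hB0) (by positivity) hk0
  have e1 : ∀ ω, (∫ y, T ω y * g y ∂surfaceMeasure) ^ 2 =
      ∫ w : S2 × S2, F (ω, w) ∂surfaceMeasure.prod surfaceMeasure := by
    intro ω
    rw [sq, ← integral_prod_mul]
  rw [integral_congr_ae (.of_forall e1), integral_integral_swap hFi]
  have e2 : ∀ w : S2 × S2, ∫ ω, F (ω, w) ∂P =
      covKernel P T (inner ℝ (w.2 : E3) (w.1 : E3)) * (g w.2 * g w.1) := by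
    intro w
    simp only [hFe]
    rw [integral_mul_const, integral_mul_eq_covKernel hI, real_inner_comm, mul_comm (g w.1)]
  have hint := hFi.integral_prod_right
  simp only [e2] at hint ⊢
  rw [integral_prod _ hint]

/-- The angular power spectrum consists of the Legendre coefficients of the covariance. -/
theorem angularPowerSpectrum_eq_integral_covKernel [IsProbabilityMeasure P]
    (hR : IsRandomField T) (hI : IsWeaklyIsotropic 2 P T) {l : ℕ} (hl : 1 ≤ l) (e : S2) :
    angularPowerSpectrum P T l = ∫ z : S2, covKernel P T (inner ℝ (z : E3) (e : E3)) *
      (legendre l).eval (inner ℝ (z : E3) (e : E3)) ∂surfaceMeasure := by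
  have hk := isBoundedKernel_covKernel hR hI
  rw [angularPowerSpectrum_eq_integral_sq hl, integral_sq_integral_mul hR hI (by fun_prop)]
  set c := ∫ z : S2, covKernel P T (inner ℝ (z : E3) (e : E3)) *
      (legendre l).eval (inner ℝ (z : E3) (e : E3)) ∂surfaceMeasure with hc
  set N := Real.sqrt ((2 * l + 1) / (4 * Real.pi)) with hN
  have h1 : ∀ x : S2, ∫ z : S2, covKernel P T (inner ℝ (z : E3) (x : E3)) *
      ((N * (legendre l).eval (inner ℝ (z : E3) (northPole : E3))) *
        (N * (legendre l).eval (inner ℝ (x : E3) (northPole : E3)))) ∂surfaceMeasure =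
      N ^ 2 * c * ((legendre l).eval (inner ℝ (x : E3) (northPole : E3)) *
        (legendre l).eval (inner ℝ (x : E3) (northPole : E3))) := by
    intro x
    have h2 : ∀ z : S2, covKernel P T (inner ℝ (z : E3) (x : E3)) *
      ((N * (legendre l).eval (inner ℝ (z : E3) (northPole : E3))) *
        (N * (legendre l).eval (inner ℝ (x : E3) (northPole : E3)))) =
      (N ^ 2 * (legendre l).eval (inner ℝ (x : E3) (northPole : E3))) *
        (covKernel P T (inner ℝ (z : E3) (x : E3)) *
          (legendre l).eval (inner ℝ (z : E3) (northPole : E3))) := fun z => by ring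
    -- Funk–Hecke reduces the double integral to c N² ∫ P_l², and N² is the inverse of ∫ P_l².
    rw [integral_congr_ae (.of_forall h2), integral_const_mul, funk_hecke hk l e,
      real_inner_comm, ← hc]
    ring
  rw [integral_congr_ae (.of_forall h1), integral_const_mul, integral_legendre_inner_sq, hN,
    Real.sq_sqrt (by positivity)]
  have := Real.pi_pos
  field_simp

/-- Bound on the variance of increments in terms of the angular power spectrum. -/
theorem covKernel_sub_le [IsProbabilityMeasure P] (hR : IsRandomField T)
    (hI : IsWeaklyIsotropic 2 P T) {β : ℝ} (hβ₀ : 0 < β) (hβ₂ : β ≤ 2)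
    (hA : Summable fun l : ℕ => angularPowerSpectrum P T l * (l : ℝ) ^ (1 + β)) (x y : S2) :
    covKernel P T 1 - covKernel P T (inner ℝ (x : E3) (y : E3)) ≤
      (∑' l : ℕ, angularPowerSpectrum P T l * (l : ℝ) ^ (1 + β)) * geodesicDist x y ^ β := by
  have hk := isBoundedKernel_covKernel hR hI
  have hlim := (tendsto_covKernel_convolution_bump hR hI x x).sub
    (tendsto_covKernel_convolution_bump hR hI x y)
  rw [inner_self_sphere] at hlim
  refine le_of_tendsto hlim (.of_forall fun n => ?_)
  obtain ⟨a, ha⟩ := exists_legendre_expansion (n + 1) (bump n) (degree_bump_lt n)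
  have hconv : ∀ y : S2, ∫ z : S2, covKernel P T (inner ℝ (z : E3) (y : E3)) *
      (bump n).eval (inner ℝ (z : E3) (x : E3)) ∂surfaceMeasure =
      ∑ l ∈ Finset.range (n + 1), a l * ((∫ z : S2, covKernel P T (inner ℝ (z : E3) (x : E3)) *
        (legendre l).eval (inner ℝ (z : E3) (x : E3)) ∂surfaceMeasure) *
        (legendre l).eval (inner ℝ (x : E3) (y : E3))) := by
    intro y
    have h1 : ∀ z : S2, covKernel P T (inner ℝ (z : E3) (y : E3)) *
        (bump n).eval (inner ℝ (z : E3) (x : E3)) = ∑ l ∈ Finset.range (n + 1), a l *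
        (covKernel P T (inner ℝ (z : E3) (y : E3)) *
          (legendre l).eval (inner ℝ (z : E3) (x : E3))) := by
      intro z
      rw [ha, Polynomial.eval_finsetSum, Finset.mul_sum]
      refine Finset.sum_congr rfl fun l _ => ?_
      rw [Polynomial.eval_mul, Polynomial.eval_C]
      ring
    rw [integral_congr_ae (.of_forall h1), integral_finsetSum _ fun l _ =>
      (hk.integrable_mul y (by fun_prop)).const_mul _]
    refine Finset.sum_congr rfl fun l _ => ?_
    rw [integral_const_mul, funk_hecke hk l x]
  rw [hconv, hconv, ← Finset.sum_sub_distrib]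
  have hnn : ∀ l : ℕ, 0 ≤ angularPowerSpectrum P T l * (l : ℝ) ^ (1 + β) := by
    intro l
    rcases Nat.eq_zero_or_pos l with rfl | hl
    -- The weight is 0 at l = 0, so the convention for A_0 plays no role.
    · simp [Real.zero_rpow (show 1 + β ≠ 0 by linarith)]
    · have := angularPowerSpectrum_nonneg (P := P) (T := T) hl
      positivity
  have hθ : 0 ≤ geodesicDist x y ^ β := Real.rpow_nonneg (geodesicDist_nonneg x y) β
  rw [← tsum_mul_right]
  refine le_trans (Finset.sum_le_sum fun l hl => ?_) ((hA.mul_right _).sum_le_tsum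
    (Finset.range (n + 1)) fun l _ => mul_nonneg (hnn l) hθ)
  rcases Nat.eq_zero_or_pos l with rfl | hl0
  -- P_0 is constant, so the part of the covariance due to the mean cancels.
  · have h0 : ∀ t : ℝ, (legendre 0).eval t = 1 := fun t => by simp [legendre]
    simp only [h0, sub_self]
    exact mul_nonneg (hnn 0) hθ
  rw [← angularPowerSpectrum_eq_integral_covKernel hR hI hl0 x, inner_self_sphere,
    eval_one_legendre]
  -- The bump is nonnegative with mass one and |P_l| ≤ 1. An upper bound suffices, since it
  -- multiplies the nonnegative A_l (1 - P_l).
  have hal : a l ≤ (2 * l + 1) / (4 * Real.pi) := by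
    rw [coeff_legendre_expansion (n + 1) a (bump n) ha (Finset.mem_range.1 hl) x]
    refine mul_le_of_le_one_right (by positivity) ?_
    refine le_trans ?_ (integral_bump n x).le
    refine integral_mono (integrable_of_continuous (by fun_prop))
      (integrable_of_continuous (by fun_prop)) fun z => ?_
    exact mul_le_of_le_one_right (eval_bump_nonneg n z x)
      (le_of_abs_le (abs_legendre_inner_le_one l z x))
  have hA0 := angularPowerSpectrum_nonneg (P := P) (T := T) hl0
  have hP := one_sub_legendre_inner_le l hl0 x y hβ₀ hβ₂
  have hP0 : 0 ≤ 1 - (legendre l).eval (inner ℝ (x : E3) (y : E3)) := by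
    linarith [le_of_abs_le (abs_legendre_inner_le_one l x y)]
  have hl1 : (1 : ℝ) ≤ l := by exact_mod_cast hl0
  -- For l ≥ 1, 2l + 1 ≤ 3l and 2π > 3, so all constants are absorbed into a single factor l.
  have hc : (2 * (l : ℝ) + 1) / (4 * Real.pi) * 2 ≤ l := by
    rw [div_mul_eq_mul_div, div_le_iff₀ (by positivity)]
    nlinarith [Real.pi_gt_three]
  calc _ = a l * (angularPowerSpectrum P T l *
          (1 - (legendre l).eval (inner ℝ (x : E3) (y : E3)))) := by ring
    _ ≤ (2 * l + 1) / (4 * Real.pi) * (angularPowerSpectrum P T l *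
          (2 * (l : ℝ) ^ β * geodesicDist x y ^ β)) := by gcongr
    _ = ((2 * l + 1) / (4 * Real.pi) * 2) * (angularPowerSpectrum P T l * (l : ℝ) ^ β *
          geodesicDist x y ^ β) := by ring
    _ ≤ l * (angularPowerSpectrum P T l * (l : ℝ) ^ β * geodesicDist x y ^ β) := by gcongr
    _ = _ := by
        rw [Real.rpow_add (by positivity), Real.rpow_one]
        ring

/-! ### Gaussian moments -/

/-- The moments of a centred Gaussian variable are powers of its standard deviation. -/
theorem exists_lintegral_enorm_pow_gaussianReal (m : ℕ) : ∃ C : ℝ≥0, ∀ v : ℝ≥0,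
    ∫⁻ x, ‖x‖ₑ ^ m ∂gaussianReal 0 v = C * ENNReal.ofReal (Real.sqrt v ^ m) := by
  have hfin : ∫⁻ x, ‖x‖ₑ ^ m ∂gaussianReal 0 1 ≠ ∞ := by
    have h := (memLp_id_gaussianReal (μ := 0) (v := 1) m).integrable_norm_pow'
    have h2 := h.2.ne
    simpa [HasFiniteIntegral] using h2
  refine ⟨(∫⁻ x, ‖x‖ₑ ^ m ∂gaussianReal 0 1).toNNReal, fun v => ?_⟩
  rw [ENNReal.coe_toNNReal hfin]
  have hmap : gaussianReal 0 v = (gaussianReal 0 1).map (fun x => Real.sqrt v * x) := by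
    rw [gaussianReal_map_const_mul, mul_zero, mul_one]
    congr
    ext
    simp
  rw [hmap, lintegral_map (by fun_prop) (by fun_prop)]
  simp only [enorm_mul, mul_pow]
  rw [lintegral_const_mul _ (by fun_prop), mul_comm]
  congr 1
  rw [Real.enorm_of_nonneg (Real.sqrt_nonneg _), ENNReal.ofReal_pow (Real.sqrt_nonneg _)]

/-- The increment is centred, because isotropy makes the mean constant, so its law is a centred
Gaussian with variance at most K dist^β; its moments scale with the square root of that bound. -/
theorem exists_moment_bound (hT : IsIsotropicGRF P T) {K β : ℝ} (hK : 0 ≤ K)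
    (hvar : ∀ x y, ∫ ω, (T ω x - T ω y) ^ 2 ∂P ≤ K * dist x y ^ β) (m : ℕ) :
    ∃ C : ℝ≥0, ∀ x y, ∫⁻ ω, ‖T ω x - T ω y‖ₑ ^ m ∂P ≤
      C * ENNReal.ofReal ((dist x y ^ (β / 2)) ^ m) := by
  obtain ⟨C, hC⟩ := exists_lintegral_enorm_pow_gaussianReal m
  have hR := hT.isRandomField
  have hI := hT.isIsotropic
  have := hT.isGaussian.isProbabilityMeasure
  refine ⟨C * (Real.sqrt K ^ m).toNNReal, fun x y => ?_⟩
  have hlaw := (hT.isGaussian.hasGaussianLaw_fun_sub (s := x) (t := y)).map_eq_gaussianReal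
  have hm : Measurable fun ω => T ω x - T ω y :=
    (hR.measurable_eval x).sub (hR.measurable_eval y)
  have hint : ∀ x, Integrable (fun ω => T ω x) P := fun x =>
    (memLp_two_eval hR hI x).integrable one_le_two
  have hmean : ∫ ω, (T ω x - T ω y) ∂P = 0 := by
    rw [integral_sub (hint x) (hint y), integral_eq_integral_of_isotropic hI x y, sub_self]
  have hV : Var[fun ω => T ω x - T ω y; P] ≤ K * dist x y ^ β := by
    rw [variance_of_integral_eq_zero hm.aemeasurable hmean]
    exact hvar x y
  rw [hmean] at hlaw
  have e : ∫⁻ ω, ‖T ω x - T ω y‖ₑ ^ m ∂P =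
      ∫⁻ s, ‖s‖ₑ ^ m ∂(P.map fun ω => T ω x - T ω y) := by
    rw [lintegral_map (by fun_prop) hm]
  rw [e, hlaw, hC, ENNReal.coe_mul, mul_assoc]
  refine mul_le_mul' le_rfl ?_
  rw [← ENNReal.ofReal, ← ENNReal.ofReal_mul (by positivity), ← mul_pow]
  refine ENNReal.ofReal_le_ofReal (pow_le_pow_left₀ (Real.sqrt_nonneg _) ?_ m)
  have hd : dist x y ^ (β / 2) = Real.sqrt (dist x y ^ β) := by
    rw [Real.sqrt_eq_rpow, ← Real.rpow_mul dist_nonneg]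
    ring_nf
  rw [hd, ← Real.sqrt_mul hK]
  refine Real.sqrt_le_sqrt ?_
  rw [Real.coe_toNNReal _ (variance_nonneg _ _)]
  exact hV

end IncrementVariance

end SphereField

end

theorem mainTheorem1 {Ω : Type*} [MeasurableSpace Ω] (P : Measure Ω) [IsProbabilityMeasure P]
    (T : Ω → SphereField.S2 → ℝ) (hT : SphereField.IsIsotropicGRF P T)
    (β : ℝ) (hβ₀ : 0 < β) (hβ₂ : β ≤ 2)
    (hA : Summable (fun l : ℕ => SphereField.angularPowerSpectrum P T l * (l : ℝ) ^ (1 + β))) :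
    ∃ T' : Ω → SphereField.S2 → ℝ,
      SphereField.IsRandomField T' ∧
      SphereField.IsModificationOf P T' T ∧
      (∀ ω, Continuous (T' ω)) ∧
      ∀ ω, ∀ γ : ℝ, 0 < γ → γ < β / 2 → SphereField.IsHolder γ (T' ω) := by
  have hR := hT.isRandomField
  have hI := hT.isIsotropic
  set S := ∑' l : ℕ, SphereField.angularPowerSpectrum P T l * (l : ℝ) ^ (1 + β)
  have hS : 0 ≤ S := tsum_nonneg fun l => by
    rcases Nat.eq_zero_or_pos l with rfl | hl
    · simp [Real.zero_rpow (show 1 + β ≠ 0 by linarith)]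
    · exact mul_nonneg (SphereField.angularPowerSpectrum_nonneg hl) (by positivity)
  -- The factor 2 comes from E(T(x) - T(y))² = 2(κ(1) - κ(⟨x, y⟩)), and (π/2)^β from replacing the
  -- geodesic distance by the chordal one used in the chaining.
  have hvar : ∀ x y, ∫ ω, (T ω x - T ω y) ^ 2 ∂P ≤
      2 * S * (Real.pi / 2) ^ β * dist x y ^ β := by
    intro x y
    rw [SphereField.integral_sub_sq hR hI, mul_assoc _ _ (dist x y ^ β),
      ← Real.mul_rpow (by positivity) dist_nonneg, mul_assoc]
    have h1 := SphereField.covKernel_sub_le hR hI hβ₀ hβ₂ hA x y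
    have h2 := mul_le_mul_of_nonneg_left (Real.rpow_le_rpow (SphereField.geodesicDist_nonneg x y)
      (SphereField.geodesicDist_le_mul_dist x y) hβ₀.le) hS
    linarith
  exact SphereField.exists_holder_modification P T hR.measurable_eval (half_pos hβ₀)
    (SphereField.exists_moment_bound hT (by positivity) hvar)
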